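/- Let $p\ge 5$ and $q\ge 3$ be integers and let $I_{p,q}$ be the Bourdon building: its chambers (tiles, which are regular right-angled hyperbolic $p$-gons) are the elements of $\Gamma_{p,q}=\langle s_1,\dots,s_p \mid s_i^q=1,\ [s_i,s_{i+1}]=1\rangle$ (indices modulo $p$), its edges are the cosets $c\langle s_i\rangle$, its vertices are the cosets $c\langle s_i,s_{i+1}\rangle$, and the link of each vertex is the complete bipartite graph $K(q,q)$. The tensor network is the graph whose nodes are the chambers, two distinct chambers being adjacent if they share an edge; $d$ denotes its graph distance. Fix a central chamber $O$, and let the layer of an edge be the least distance from $O$ of a chamber containing it. A wall is a bi-infinite geodesic contained in the 1-skeleton of $I_{p,q}$, i.e. an edge path any two consecutive edges of which are at distance $2$ in the link of their common vertex; the tree-wall of an edge $e$ is the set of all edges that share a wall with $e$. The half-tree-wall starting at a vertex $v$ with an edge $e$ at $v$ is the set of all edges on geodesic rays in the 1-skeleton that start at $v$ along $e$. Two half-tree-walls are attached to each other if they start at the same vertex $v$ with the two sides of some chamber which meet in $v$. For a chamber $z$ with $d(O,z)=g$, the ball entanglement wedge $R$ starting at $z$ is the set of all chambers lying on semi-infinite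 geodesics of the tensor network that start from $z$ and can be extended to semi-infinite geodesics starting from $O$. Its boundary $\partial R$ consists of the edges that lie both on a chamber in $R$ and on a chamber not in $R$; it is the edge set by which $R$ is delimited. Let $\Lambda\ge g$ be the layer at which the network is cut off. Then the set of edges of $\partial R$ at layer less than $\Lambda$ is finite, and it is the same as the set of edges of $\partial R$ which lie on a tile of $R$ at distance at most $\Lambda$ from $O$. The number $N_{tiles}$ of its elements is $$N_{tiles}=\frac{2}{q-2}\left((q-1)^{\Lambda-g+1}-1\right)-1$$ if $\partial R$ is a tree-wall, and $$N_{tiles}=\frac{2}{q-2}\left((q-1)^{\Lambda-g+1}-1\right)$$ if $\partial R$ is the union of two half-tree-walls attached to each other. -/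

import Mathlib

/-! # The Bourdon building `I_{p,q}` as a coset complex, tree-walls and ball entanglement wedges -/

namespace Bourdon

/-- The relators of `Γ_{p,q} = ⟨s_1, …, s_p | s_i ^ q = 1, [s_i, s_{i+1}] = 1⟩`; the generators are
indexed cyclically by `ZMod p`. -/
def relators (p q : ℕ) : Set (FreeGroup (ZMod p)) :=
  {r | ∃ i : ZMod p, r = FreeGroup.of i ^ q} ∪
  {r | ∃ i : ZMod p,
    r = FreeGroup.of i * FreeGroup.of (i + 1) * (FreeGroup.of i)⁻¹ * (FreeGroup.of (i + 1))⁻¹}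

/-- The group `Γ_{p,q}`. It acts simply transitively on the chambers (the `p`-gons, or tiles)
of `I_{p,q}`, so its elements are the chambers. -/
abbrev Chamber (p q : ℕ) : Type := PresentedGroup (relators p q)

/-- The standard generator `s_i` of `Γ_{p,q}`. It rotates the building around the `i`-th edge of
the base chamber. -/
def gen (p q : ℕ) (i : ZMod p) : Chamber p q := PresentedGroup.of i

/-- The stabiliser of the `i`-th edge of the base chamber. -/
def edgeGroup (p q : ℕ) (i : ZMod p) : Subgroup (Chamber p q) :=
  Subgroup.closure {gen p q i}

/-- The stabiliser of the vertex of the base chamber in which the `i`-th and the `(i+1)`-st edge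
meet. -/
def vertexGroup (p q : ℕ) (i : ZMod p) : Subgroup (Chamber p q) :=
  Subgroup.closure {gen p q i, gen p q (i + 1)}

/-- The edges (1-cells) of `I_{p,q}`: the left cosets `c ⟨s_i⟩`. -/
def Edge (p q : ℕ) : Type := Σ i : ZMod p, Chamber p q ⧸ edgeGroup p q i

/-- The vertices (0-cells) of `I_{p,q}`: the left cosets `c ⟨s_i, s_{i+1}⟩`. -/
def Vertex (p q : ℕ) : Type := Σ i : ZMod p, Chamber p q ⧸ vertexGroup p q i

variable {p q : ℕ}

/-- The chambers that contain a given edge. -/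
def Edge.chambers (e : Edge p q) : Set (Chamber p q) :=
  {c | (QuotientGroup.mk c : Chamber p q ⧸ edgeGroup p q e.1) = e.2}

/-- The chambers that contain a given vertex. -/
def Vertex.chambers (v : Vertex p q) : Set (Chamber p q) :=
  {c | (QuotientGroup.mk c : Chamber p q ⧸ vertexGroup p q v.1) = v.2}

/-- The vertex `v` is an endpoint of the edge `e`: some chamber contains both, and in this chamber
`e` is one of the two sides that meet in the corner `v`. -/
def IsEndpoint (v : Vertex p q) (e : Edge p q) : Prop :=
  (e.1 = v.1 ∨ e.1 = v.1 + 1) ∧ (e.chambers ∩ v.chambers).Nonempty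

/-- The link of a vertex: its vertices are the edges of the building at `v`, two of them being
adjacent if they are sides of a common chamber. -/
def link (v : Vertex p q) : SimpleGraph {e : Edge p q // IsEndpoint v e} where
  Adj e f := e ≠ f ∧ (e.1.chambers ∩ f.1.chambers).Nonempty
  symm := ⟨fun _ _ h => ⟨h.1.symm, by rw [Set.inter_comm]; exact h.2⟩⟩
  loopless := ⟨fun _ h => h.1 rfl⟩

/-- The graph of the tensor network: two distinct chambers are adjacent if they share an edge.
Distances between chambers are distances in this graph. -/
def network (p q : ℕ) : SimpleGraph (Chamber p q) where
  Adj c d := c ≠ d ∧ ∃ e : Edge p q, c ∈ e.chambers ∧ d ∈ e.chambers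
  symm := ⟨fun _ _ h => ⟨h.1.symm, h.2.imp fun _ he => ⟨he.2, he.1⟩⟩⟩
  loopless := ⟨fun _ h => h.1 rfl⟩

/-! ### Walls, tree-walls, half-tree-walls -/

/-- An edge path passing from `e` to `f` through their common endpoint `v` goes straight on
at `v`: `e` and `f` are at distance `2` in the link graph. As every corner of a chamber is a right
angle, this says that `e` and `f` enclose the angle `π`. -/
def StraightAt (v : Vertex p q) (e f : Edge p q) : Prop :=
  ∃ (he : IsEndpoint v e) (hf : IsEndpoint v f), (link v).dist ⟨e, he⟩ ⟨f, hf⟩ = 2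

/-- A wall: a bi-infinite geodesic contained in the 1-skeleton, given by its successive edges.
The `n`-th edge runs from the vertex `v n` to the vertex `v (n + 1)`. (The building carries a
CAT(-1) metric, so a path is a geodesic if and only if it is straight at all its vertices.) -/
def IsWall (γ : ℤ → Edge p q) : Prop :=
  ∃ v : ℤ → Vertex p q, ∀ n, v n ≠ v (n + 1) ∧ StraightAt (v (n + 1)) (γ n) (γ (n + 1))

/-- The tree-wall of an edge `e`: all edges that share a wall with `e`. -/
def treeWall (e : Edge p q) : Set (Edge p q) :=
  {f | ∃ γ : ℤ → Edge p q, IsWall γ ∧ e ∈ Set.range γ ∧ f ∈ Set.range γ}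

/-- `S` is (the edge set of) a tree-wall. -/
def IsTreeWall (S : Set (Edge p q)) : Prop := ∃ e : Edge p q, S = treeWall e

/-- A geodesic ray in the 1-skeleton which starts at the vertex `v` along the edge `e`, given by
its successive edges. -/
def IsWallRay (v : Vertex p q) (e : Edge p q) (γ : ℕ → Edge p q) : Prop :=
  γ 0 = e ∧ ∃ w : ℕ → Vertex p q, w 0 = v ∧ IsEndpoint v e ∧
    ∀ n, w n ≠ w (n + 1) ∧ StraightAt (w (n + 1)) (γ n) (γ (n + 1))

/-- The half-tree-wall which starts at `v` with the edge `e`: the branch of the tree-wall of `e`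
at `v` that contains `e`. -/
def halfTreeWall (v : Vertex p q) (e : Edge p q) : Set (Edge p q) :=
  {f | ∃ γ : ℕ → Edge p q, IsWallRay v e γ ∧ f ∈ Set.range γ}

/-- `S` consists of two half-tree-walls attached to each other: they start at a common vertex `v`
with the two sides of some chamber `c` which meet in `v`. -/
def IsTwoHalfTreeWalls (S : Set (Edge p q)) : Prop :=
  ∃ (v : Vertex p q) (c : Chamber p q) (e f : Edge p q), e ≠ f ∧
    IsEndpoint v e ∧ IsEndpoint v f ∧ c ∈ e.chambers ∧ c ∈ f.chambers ∧
    S = halfTreeWall v e ∪ halfTreeWall v f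

/-! ### Ball entanglement wedges -/

/-- A semi-infinite geodesic on the tensor network. -/
def IsGeodesicRay (γ : ℕ → Chamber p q) : Prop :=
  ∀ m n : ℕ, m ≤ n → (network p q).dist (γ m) (γ n) = n - m

/-- The ball entanglement wedge defined by the chamber `z` and the central chamber `O`: the
chambers on those semi-infinite geodesics starting from `z` which extend to a semi-infinite
geodesic starting from `O`. -/
def ballWedge (O z : Chamber p q) : Set (Chamber p q) :=
  {c | ∃ γ : ℕ → Chamber p q, IsGeodesicRay γ ∧ γ 0 = O ∧
    ∃ m : ℕ, γ m = z ∧ ∃ n : ℕ, m ≤ n ∧ γ n = c}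

/-- The tile edges contained in the boundary of a region `R`, a set of chambers: the edges that lie
both on a chamber in `R` and on a chamber outside `R`. -/
def boundaryEdges (R : Set (Chamber p q)) : Set (Edge p q) :=
  {e | (e.chambers ∩ R).Nonempty ∧ (e.chambers ∩ Rᶜ).Nonempty}

/-- The layer of an edge: the least distance from `O` of a chamber that contains the edge. -/
noncomputable def edgeLayer (O : Chamber p q) (e : Edge p q) : ℕ :=
  sInf {n | ∃ c ∈ e.chambers, (network p q).dist O c = n}

end Bourdon

/-!
The chambers of the building are the elements of the graph product `Γ_{p,q}`, and the distance in
the tensor network is the number of syllables of a reduced word. No normal form theorem is used.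
Instead, the affine maps `f ↦ δ_i + s_i • f`, on the functions from the hyperplanes (cosets of the
star groups `⟨s_{i-1}, s_i, s_{i+1}⟩`, which are the tree-walls) to `ℤ/q`, satisfy the relations of
`Γ_{p,q}`. The resulting cocycle `coord` records in which of the `q` sectors of each hyperplane a
chamber lies. A shortest word crosses no hyperplane twice: letters between two crossings of the same
hyperplane may be replaced by their images under the retraction onto the star group, and then
commute with the crossing letter. So distances count separating hyperplanes
(`exists_geodesic_word`, `network_dist`), and the network embeds isometrically in a Hamming graph.

Every geodesic can be prolonged, so with `O = 1` the wedge at `z` consists of the chambers `z w`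
with `|z w| = |z| + |w|` (`mem_ballWedge_iff`), that is, of those `z w` for which `w` does not begin
with a syllable whose type is that of a last syllable of `z` (`len_mul_eq_iff_isLast`). A geodesic
that crosses a hyperplane before `z` and ends next to it runs along it after `z`
(`near_of_coord_ne_zero`). Hence the boundary edges are the cosets `z w ⟨s_j⟩`, with `j` the type of
a last syllable of `z` and `w` a reduced word in `s_{j-1}`, `s_{j+1}` that begins with no type of
last syllable of `z` (`mem_boundaryEdges_iff`). Such an edge has exactly one chamber `z w` in the
wedge, and its layer is `|z| + |w| - 1`.

The last syllables of `z` have at most two types, and two of them are consecutive. A straight edge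
path keeps its type because the links are complete bipartite. So the boundary can be a tree-wall only
if there is one type `j`; then all reduced words in `s_{j-1}`, `s_{j+1}` count. It can be a union of
two attached half-tree-walls only if there are two types `i`, `i + 1`; then for each of them, only the
words with one prescribed first letter, and the empty word, count. Geometric series give the
two formulas.
-/

namespace Bourdon

variable {p q : ℕ}

/-! ### Syllables and hyperplanes -/

lemma gen_pow_card (i : ZMod p) : gen p q i ^ q = 1 := by
  have h : (QuotientGroup.mk (FreeGroup.of i ^ q) : PresentedGroup (relators p q)) = 1 :=
    PresentedGroup.one_of_mem (Or.inl ⟨i, rfl⟩)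
  exact h

lemma gen_mul_gen_succ (i : ZMod p) :
    gen p q i * gen p q (i + 1) = gen p q (i + 1) * gen p q i := by
  have h : gen p q i * gen p q (i + 1) * (gen p q i)⁻¹ * (gen p q (i + 1))⁻¹ = 1 :=
    PresentedGroup.one_of_mem (rels := relators p q) (Or.inr ⟨i, rfl⟩)
  have h' := mul_inv_eq_one.1 h
  exact mul_inv_eq_iff_eq_mul.1 h'

/-- The power `s_i ^ k` of a generator, for an exponent `k` modulo `q`. -/
def syl (i : ZMod p) (k : ZMod q) : Chamber p q :=
  (ZMod.lift q ⟨zmultiplesHom (Additive (Chamber p q)) (Additive.ofMul (gen p q i)), by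
    simp only [zmultiplesHom_apply, natCast_zsmul, ← ofMul_pow, gen_pow_card, ofMul_one]⟩ k).toMul

lemma syl_add (i : ZMod p) (a b : ZMod q) : syl i (a + b) = syl i a * syl i b := by
  simp [syl]

@[simp] lemma syl_zero (i : ZMod p) : syl i (0 : ZMod q) = 1 := by simp [syl]

lemma syl_intCast (i : ZMod p) (n : ℤ) : syl i (n : ZMod q) = gen p q i ^ n := by
  simp [syl]

@[simp] lemma syl_one (i : ZMod p) : syl i (1 : ZMod q) = gen p q i := by
  simpa using syl_intCast (q := q) i 1

lemma syl_neg (i : ZMod p) (a : ZMod q) : syl i (-a) = (syl i a)⁻¹ := by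
  simp [syl]

lemma mem_edgeGroup {i : ZMod p} {c : Chamber p q} :
    c ∈ edgeGroup p q i ↔ ∃ k : ZMod q, c = syl i k := by
  rw [edgeGroup, Subgroup.mem_closure_singleton]
  constructor
  · rintro ⟨n, rfl⟩
    exact ⟨n, (syl_intCast i n).symm⟩
  · rintro ⟨k, rfl⟩
    obtain ⟨n, rfl⟩ := ZMod.intCast_surjective k
    exact ⟨n, (syl_intCast i n).symm⟩

lemma syl_mul_syl_of_gen_commute {i j : ZMod p} (h : Commute (gen p q i) (gen p q j))
    (a b : ZMod q) : Commute (syl i a) (syl j b) := by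
  obtain ⟨m, rfl⟩ := ZMod.intCast_surjective a
  obtain ⟨n, rfl⟩ := ZMod.intCast_surjective b
  rw [syl_intCast, syl_intCast]
  exact h.zpow_zpow m n

/-- Two generators are adjacent if their indices are cyclically consecutive. -/
def Near (i j : ZMod p) : Prop := j = i - 1 ∨ j = i + 1

instance (i j : ZMod p) : Decidable (Near i j) := by unfold Near; infer_instance

lemma Near.symm {i j : ZMod p} (h : Near i j) : Near j i := by
  rcases h with rfl | rfl
  · right; ring
  · left; ring

lemma Near.commute {i j : ZMod p} (h : Near i j) (a b : ZMod q) :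
    Commute (syl i a) (syl j b) := by
  refine syl_mul_syl_of_gen_commute ?_ a b
  rcases h with rfl | rfl
  · have := gen_mul_gen_succ (p := p) (q := q) (i - 1)
    rw [sub_add_cancel] at this
    exact this.symm
  · exact gen_mul_gen_succ i

/-- The subgroup generated by `s_i` and the two generators adjacent to it. It is the stabiliser of
the tree-wall through the `i`-th edge of the base chamber. -/
def starGroup (p q : ℕ) (i : ZMod p) : Subgroup (Chamber p q) :=
  Subgroup.closure {c | ∃ j, (j = i ∨ Near i j) ∧ c = gen p q j}

lemma gen_mem_starGroup {i j : ZMod p} (h : j = i ∨ Near i j) :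
    gen p q j ∈ starGroup p q i := Subgroup.subset_closure ⟨j, h, rfl⟩

lemma syl_mem_starGroup {i j : ZMod p} (h : j = i ∨ Near i j) (k : ZMod q) :
    syl j k ∈ starGroup p q i := by
  obtain ⟨n, rfl⟩ := ZMod.intCast_surjective k
  rw [syl_intCast]
  exact zpow_mem (gen_mem_starGroup h) n

/-- The hyperplanes of the building, as left cosets of the groups `starGroup p q i`. They
correspond to the tree-walls. -/
abbrev Hyperplane (p q : ℕ) : Type := Σ i : ZMod p, Chamber p q ⧸ starGroup p q i

/-- The hyperplane dual to the `i`-th edge of the chamber `c`. -/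
def hyp (i : ZMod p) (c : Chamber p q) : Hyperplane p q := ⟨i, QuotientGroup.mk c⟩

lemma hyp_eq_iff {i j : ZMod p} {c d : Chamber p q} :
    hyp i c = hyp j d ↔ i = j ∧ c⁻¹ * d ∈ starGroup p q i := by
  constructor
  · intro h
    have h1 : i = j := congrArg Sigma.fst h
    subst h1
    refine ⟨rfl, ?_⟩
    have h2 := eq_of_heq (Sigma.mk.inj h).2
    exact QuotientGroup.eq.1 h2
  · rintro ⟨rfl, h⟩
    exact congrArg (Sigma.mk i) (QuotientGroup.eq.2 h)

lemma smul_hyp (g : Chamber p q) (i : ZMod p) (c : Chamber p q) :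
    g • hyp i c = hyp i (g * c) := rfl

lemma hyp_mul_of_mem {i : ZMod p} {u : Chamber p q} (c : Chamber p q)
    (h : u ∈ starGroup p q i) : hyp i (c * u) = hyp i c := by
  rw [eq_comm, hyp_eq_iff]
  simpa using h

/-! ### The coordinate cocycle -/

open Classical in
/-- The function on hyperplanes with value `1` at the hyperplane of the `i`-th edge of the base
chamber, and `0` elsewhere. -/
noncomputable def delta (q : ℕ) (i : ZMod p) : Hyperplane p q → ZMod q :=
  fun W => if W = hyp i 1 then 1 else 0

/-- The affine transformation `f ↦ δ_i + s_i • f` of the functions on hyperplanes. -/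
noncomputable def affineGen (q : ℕ) (i : ZMod p) : Equiv.Perm (Hyperplane p q → ZMod q) where
  toFun f := fun W => delta q i W + f ((gen p q i)⁻¹ • W)
  invFun f := fun W => f (gen p q i • W) - delta q i (gen p q i • W)
  left_inv f := by funext W; simp
  right_inv f := by funext W; simp

lemma delta_inv_smul {i : ZMod p} {u : Chamber p q} (hu : u ∈ starGroup p q i)
    (W : Hyperplane p q) : delta q i (u⁻¹ • W) = delta q i W := by
  have : u⁻¹ • W = hyp i 1 ↔ W = hyp i 1 := by
    rw [inv_smul_eq_iff, smul_hyp, mul_one]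
    conv_lhs => rw [← one_mul u, hyp_mul_of_mem 1 hu]
  by_cases hW : W = hyp i 1
  · rw [delta, delta, if_pos hW, if_pos (this.2 hW)]
  · rw [delta, delta, if_neg hW, if_neg fun h => hW (this.1 h)]

lemma affineGen_pow (i : ZMod p) (n : ℕ) (f : Hyperplane p q → ZMod q) (W : Hyperplane p q) :
    (affineGen q i ^ n) f W = n * delta q i W + f ((gen p q i ^ n)⁻¹ • W) := by
  induction n generalizing W with
  | zero => simp
  | succ n ih =>
    rw [pow_succ']
    change delta q i W + (affineGen q i ^ n) f ((gen p q i)⁻¹ • W) = _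
    rw [ih, delta_inv_smul (gen_mem_starGroup (Or.inl rfl)), smul_smul, ← mul_inv_rev,
      ← pow_succ']
    push_cast
    ring

/-- The affine action of the group on the functions on hyperplanes. -/
noncomputable def affineAction (p q : ℕ) :
    Chamber p q →* Equiv.Perm (Hyperplane p q → ZMod q) :=
  PresentedGroup.toGroup (f := affineGen q) <| by
    rintro r (⟨i, rfl⟩ | ⟨i, rfl⟩)
    · rw [map_pow, FreeGroup.lift_apply_of]
      ext f W
      simp [affineGen_pow, gen_pow_card]
    · simp only [map_mul, map_inv, FreeGroup.lift_apply_of]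
      rw [mul_inv_eq_one, mul_inv_eq_iff_eq_mul]
      refine Equiv.ext fun f => funext fun W => ?_
      change delta q i W + (delta q (i + 1) ((gen p q i)⁻¹ • W) +
          f ((gen p q (i + 1))⁻¹ • (gen p q i)⁻¹ • W)) =
        delta q (i + 1) W + (delta q i ((gen p q (i + 1))⁻¹ • W) +
          f ((gen p q i)⁻¹ • (gen p q (i + 1))⁻¹ • W))
      rw [delta_inv_smul (gen_mem_starGroup (Or.inr (Or.inl (by ring)))),
        delta_inv_smul (gen_mem_starGroup (Or.inr (Or.inr rfl))), smul_smul, smul_smul,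
        ← mul_inv_rev, ← mul_inv_rev, gen_mul_gen_succ]
      ring

/-- The coordinates of a chamber: `coord c W` tells in which of the `q` sectors of the
hyperplane `W` the chamber `c` lies, the sector of the base chamber being `0`. -/
noncomputable def coord (c : Chamber p q) : Hyperplane p q → ZMod q := affineAction p q c 0

lemma affineAction_apply (c : Chamber p q) (f : Hyperplane p q → ZMod q) (W : Hyperplane p q) :
    affineAction p q c f W = coord c W + f (c⁻¹ • W) := by
  have hgen : ∀ i f W, affineAction p q (gen p q i) f W =
      delta q i W + f ((gen p q i)⁻¹ • W) := fun i f W => by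
    have : affineAction p q (gen p q i) = affineGen q i := PresentedGroup.toGroup.of _
    rw [this]; rfl
  have hmem : c ∈ Subgroup.closure (Set.range (gen p q)) := by
    have := PresentedGroup.closure_range_of (relators p q)
    change c ∈ Subgroup.closure (Set.range (PresentedGroup.of (rels := relators p q)))
    rw [this]; trivial
  induction hmem using Subgroup.closure_induction generalizing f W with
  | mem x hx =>
    obtain ⟨i, rfl⟩ := hx
    simp [coord, hgen]
  | one => simp [coord]
  | mul x y _ _ hx hy =>
    simp only [coord, map_mul, Equiv.Perm.mul_apply]
    rw [hx, hx (affineAction p q y 0), hy, hy 0]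
    simp [coord, smul_smul, add_assoc]
  | inv x _ hx =>
    have h1 : ∀ f W, affineAction p q x (affineAction p q x⁻¹ f) W = f W := by
      intro f W; simp
    have h2 := h1 f (x • W)
    have h3 := h1 0 (x • W)
    rw [hx] at h2 h3
    simp only [inv_smul_smul] at h2 h3
    simp only [coord, inv_inv] at *
    rw [← h2]
    simp only [Pi.zero_apply] at h3
    linear_combination -h3

@[simp] lemma coord_one (W : Hyperplane p q) : coord 1 W = 0 := by simp [coord]

lemma coord_mul (g h : Chamber p q) (W : Hyperplane p q) :
    coord (g * h) W = coord g W + coord h (g⁻¹ • W) := by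
  rw [← affineAction_apply]
  simp [coord]

lemma coord_gen (i : ZMod p) (W : Hyperplane p q) : coord (gen p q i) W = delta q i W := by
  have : affineAction p q (gen p q i) = affineGen q i := PresentedGroup.toGroup.of _
  rw [coord, this]
  simp [affineGen]

lemma coord_syl (i : ZMod p) (k : ZMod q) (W : Hyperplane p q) :
    coord (syl i k) W = k * delta q i W := by
  obtain ⟨n, rfl⟩ := ZMod.intCast_surjective k
  have step : ∀ n : ℤ, coord (syl i ((n + 1 : ℤ) : ZMod q)) W =
      coord (syl i (n : ZMod q)) W + delta q i W := by
    intro n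
    rw [Int.cast_add, syl_add, Int.cast_one, coord_mul, syl_one, coord_gen,
      delta_inv_smul (syl_mem_starGroup (Or.inl rfl) _)]
  induction n using Int.induction_on with
  | zero => simp
  | succ n ih => rw [step, ih]; push_cast; ring
  | pred n ih =>
    have := step (-n - 1)
    rw [sub_add_cancel, ih] at this
    push_cast at this ⊢
    linear_combination -this

@[simp] lemma coord_syl_self (i : ZMod p) (k : ZMod q) : coord (syl i k) (hyp i 1) = k := by
  simp [coord_syl, delta]

lemma coord_syl_of_ne {i : ZMod p} {W : Hyperplane p q} (h : W ≠ hyp i 1) (k : ZMod q) :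
    coord (syl i k) W = 0 := by
  simp [coord_syl, delta, h]

lemma coord_mul_syl_self (c : Chamber p q) (i : ZMod p) (k : ZMod q) :
    coord (c * syl i k) (hyp i c) = coord c (hyp i c) + k := by
  rw [coord_mul, smul_hyp, inv_mul_cancel, coord_syl_self]

lemma coord_mul_syl_of_ne {c : Chamber p q} {i : ZMod p} {W : Hyperplane p q}
    (h : W ≠ hyp i c) (k : ZMod q) : coord (c * syl i k) W = coord c W := by
  rw [coord_mul, coord_syl_of_ne, add_zero]
  rwa [Ne, inv_smul_eq_iff, smul_hyp, mul_one]

lemma coord_inv (c : Chamber p q) (W : Hyperplane p q) : coord c⁻¹ W = -coord c (c • W) := by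
  have := coord_mul c⁻¹ c W
  rw [inv_mul_cancel, coord_one, inv_inv] at this
  linear_combination -this

/-! ### Words and the syllable length -/

/-- The element of the group spelled by a word in the syllables `s_i ^ k`. -/
def ev (l : List (ZMod p × ZMod q)) : Chamber p q := (l.map fun x => syl x.1 x.2).prod

@[simp] lemma ev_nil : ev ([] : List (ZMod p × ZMod q)) = 1 := rfl

@[simp] lemma ev_cons (x : ZMod p × ZMod q) (l : List (ZMod p × ZMod q)) :
    ev (x :: l) = syl x.1 x.2 * ev l := by simp [ev]

@[simp] lemma ev_append (l₁ l₂ : List (ZMod p × ZMod q)) : ev (l₁ ++ l₂) = ev l₁ * ev l₂ := by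
  simp [ev]

lemma exists_ev_eq (c : Chamber p q) : ∃ l, ev l = c := by
  have hmem : c ∈ Subgroup.closure (Set.range (gen p q)) := by
    have := PresentedGroup.closure_range_of (relators p q)
    change c ∈ Subgroup.closure (Set.range (PresentedGroup.of (rels := relators p q)))
    rw [this]; trivial
  induction hmem using Subgroup.closure_induction with
  | mem x hx =>
    obtain ⟨i, rfl⟩ := hx
    exact ⟨[(i, 1)], by simp⟩
  | one => exact ⟨[], rfl⟩
  | mul x y _ _ hx hy =>
    obtain ⟨l, rfl⟩ := hx
    obtain ⟨m, rfl⟩ := hy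
    exact ⟨l ++ m, by simp⟩
  | inv x _ hx =>
    obtain ⟨l, rfl⟩ := hx
    clear * -
    induction l with
    | nil => exact ⟨[], by simp⟩
    | cons x l ih =>
      obtain ⟨m, hm⟩ := ih
      exact ⟨m ++ [(x.1, -x.2)], by simp [hm, syl_neg]⟩

/-- The number of hyperplanes that separate the chamber `c` from the base chamber. -/
noncomputable def len (c : Chamber p q) : ℕ := {W | coord c W ≠ 0}.ncard

lemma support_mul_subset (g h : Chamber p q) :
    {W | coord (g * h) W ≠ 0} ⊆ {W | coord g W ≠ 0} ∪ (g • ·) '' {W | coord h W ≠ 0} := by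
  intro W hW
  by_cases h1 : coord g W = 0
  · refine Or.inr ⟨g⁻¹ • W, ?_, by simp⟩
    simpa [coord_mul, h1] using hW
  · exact Or.inl h1

lemma support_syl_subset (i : ZMod p) (k : ZMod q) :
    {W | coord (syl i k) W ≠ 0} ⊆ {hyp i 1} := by
  intro W hW
  by_contra h
  exact hW (coord_syl_of_ne h k)

lemma finite_support (c : Chamber p q) : {W | coord c W ≠ 0}.Finite := by
  obtain ⟨l, rfl⟩ := exists_ev_eq c
  induction l with
  | nil => simp
  | cons x l ih =>
    rw [ev_cons]
    exact (((Set.finite_singleton _).subset (support_syl_subset x.1 x.2)).union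
      (ih.image _)).subset (support_mul_subset _ _)

@[simp] lemma len_one : len (1 : Chamber p q) = 0 := by simp [len]

lemma ncard_smul_support (g h : Chamber p q) :
    ((g • ·) '' {W | coord h W ≠ 0}).ncard = len h :=
  Set.ncard_image_of_injective _ (MulAction.injective g)

lemma len_mul_le (g h : Chamber p q) : len (g * h) ≤ len g + len h := by
  rw [← ncard_smul_support g h]
  exact (Set.ncard_le_ncard (support_mul_subset g h)
    ((finite_support g).union ((finite_support h).image _))).trans (Set.ncard_union_le _ _)

/-- Lengths add up exactly if no hyperplane is crossed twice. -/
lemma len_mul_eq_iff (g h : Chamber p q) :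
    len (g * h) = len g + len h ↔ ∀ W, coord g W ≠ 0 → coord h (g⁻¹ • W) = 0 := by
  have hf1 := finite_support g
  have hf2 := (finite_support h).image (g • ·)
  constructor
  · intro hlen
    have h1 := Set.ncard_le_ncard (support_mul_subset g h) (hf1.union hf2)
    have h2 := Set.ncard_union_add_ncard_inter _ _ hf1 hf2
    rw [ncard_smul_support] at h2
    change len (g * h) ≤ _ at h1
    change _ = len g + _ at h2
    have h3 : ({W | coord g W ≠ 0} ∩ (g • ·) '' {W | coord h W ≠ 0}).ncard = 0 := by omega
    rw [Set.ncard_eq_zero (hf1.inter_of_left _)] at h3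
    intro W hW
    by_contra hne
    have : W ∈ {W | coord g W ≠ 0} ∩ (g • ·) '' {W | coord h W ≠ 0} :=
      ⟨hW, g⁻¹ • W, hne, by simp⟩
    rw [h3] at this
    exact this
  · intro hdis
    rw [← ncard_smul_support g h, len, len, ← Set.ncard_union_eq ?_ hf1 hf2]
    · congr 1
      refine (support_mul_subset g h).antisymm ?_
      rintro W (hW | ⟨V, hV, rfl⟩)
      · change _ ≠ _
        rwa [coord_mul, hdis W hW, add_zero]
      · change coord (g * h) (g • V) ≠ 0
        rw [coord_mul, inv_smul_smul]
        have : coord g (g • V) = 0 := by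
          by_contra hne
          exact hV (by simpa using hdis _ hne)
        rwa [this, zero_add]
    · rw [Set.disjoint_left]
      rintro W hW ⟨V, hV, rfl⟩
      exact hV (by simpa using hdis _ hW)

lemma len_syl_le (i : ZMod p) (k : ZMod q) : len (syl i k) ≤ 1 := by
  rw [← Set.ncard_singleton (hyp (q := q) i 1)]
  exact Set.ncard_le_ncard (support_syl_subset i k)

lemma len_syl {i : ZMod p} {k : ZMod q} (hk : k ≠ 0) : len (syl i k) = 1 := by
  rw [len, Set.ncard_eq_one]
  refine ⟨hyp i 1, (support_syl_subset i k).antisymm ?_⟩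
  rintro _ rfl
  simpa using hk

lemma len_ev_le (l : List (ZMod p × ZMod q)) : len (ev l) ≤ l.length := by
  induction l with
  | nil => simp
  | cons x l ih =>
    rw [ev_cons, List.length_cons]
    have := len_mul_le (syl x.1 x.2) (ev l)
    have := len_syl_le x.1 x.2
    omega

/-- A word that ends on the far side of a hyperplane has a letter which crosses it. -/
lemma exists_crossing (l : List (ZMod p × ZMod q)) (i : ZMod p) (c : Chamber p q)
    (h : coord (ev l) (hyp i c) ≠ 0) :
    ∃ l₁ m l₂, l = l₁ ++ (i, m) :: l₂ ∧ (ev l₁)⁻¹ * c ∈ starGroup p q i := by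
  induction l generalizing c with
  | nil => simp at h
  | cons x l ih =>
    by_cases hx : coord (syl x.1 x.2) (hyp i c) = 0
    · rw [ev_cons, coord_mul, hx, zero_add, smul_hyp] at h
      obtain ⟨l₁, m, l₂, rfl, hl⟩ := ih _ h
      refine ⟨x :: l₁, m, l₂, rfl, ?_⟩
      rwa [ev_cons, mul_inv_rev, mul_assoc]
    · have h1 : hyp i c = hyp x.1 1 := by
        by_contra hne
        exact hx (coord_syl_of_ne hne _)
      obtain ⟨rfl, h2⟩ := hyp_eq_iff.1 h1.symm
      exact ⟨[], x.2, l, rfl, by simpa using h2⟩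

/-- The retraction of the group onto `starGroup p q i` that kills the other generators. -/
noncomputable def retract (p q : ℕ) (i : ZMod p) : Chamber p q →* Chamber p q :=
  PresentedGroup.toGroup (f := fun j => if j = i ∨ Near i j then gen p q j else 1) <| by
    rintro r (⟨j, rfl⟩ | ⟨j, rfl⟩)
    · rw [map_pow, FreeGroup.lift_apply_of]
      split_ifs
      · exact gen_pow_card j
      · simp
    · simp only [map_mul, map_inv, FreeGroup.lift_apply_of]
      rw [mul_inv_eq_one, mul_inv_eq_iff_eq_mul]
      split_ifs <;> simp [gen_mul_gen_succ]

lemma retract_gen (i j : ZMod p) :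
    retract p q i (gen p q j) = if j = i ∨ Near i j then gen p q j else 1 :=
  PresentedGroup.toGroup.of _

lemma retract_syl (i j : ZMod p) (k : ZMod q) :
    retract p q i (syl j k) = if j = i ∨ Near i j then syl j k else 1 := by
  obtain ⟨n, rfl⟩ := ZMod.intCast_surjective k
  rw [syl_intCast, map_zpow, retract_gen]
  split_ifs <;> simp

lemma retract_of_mem {i : ZMod p} {c : Chamber p q} (h : c ∈ starGroup p q i) :
    retract p q i c = c := by
  have hle : starGroup p q i ≤ (retract p q i).eqLocus (MonoidHom.id _) := by
    rw [starGroup, Subgroup.closure_le]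
    rintro _ ⟨j, hj, rfl⟩
    change retract p q i (gen p q j) = gen p q j
    rw [retract_gen, if_pos hj]
  exact hle h

/-- A word that represents an element of `starGroup p q i` may be shortened to its letters adjacent
to `i`, at the cost of a single letter `i`. -/
lemma ev_eq_of_mem_starGroup {i : ZMod p} {l : List (ZMod p × ZMod q)}
    (h : ev l ∈ starGroup p q i) :
    ∃ a : ZMod q, ev l = syl i a * ev (l.filter fun x => Near i x.1) := by
  rw [← retract_of_mem h]
  clear h
  induction l with
  | nil => exact ⟨0, by simp⟩
  | cons x l ih =>
    obtain ⟨a, ha⟩ := ih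
    rw [ev_cons, map_mul, ha, retract_syl]
    by_cases h1 : Near i x.1
    · refine ⟨a, ?_⟩
      rw [if_pos (Or.inr h1), List.filter_cons_of_pos (by simpa using h1), ev_cons, ← mul_assoc,
        ← mul_assoc, (h1.commute a x.2).eq]
    · rw [List.filter_cons_of_neg (by simpa using h1)]
      by_cases h2 : x.1 = i
      · refine ⟨x.2 + a, ?_⟩
        rw [if_pos (Or.inl h2), h2, syl_add, mul_assoc]
      · exact ⟨a, by rw [if_neg (by tauto), one_mul]⟩

lemma ev_filter_near_commute (i : ZMod p) (m : ZMod q) (l : List (ZMod p × ZMod q)) :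
    Commute (syl i m) (ev (l.filter fun x => Near i x.1)) := by
  rw [ev]
  refine Commute.list_prod_right _ _ ?_
  intro y hy
  obtain ⟨x, hx, rfl⟩ := List.mem_map.1 hy
  have : Near i x.1 := by simpa using (List.mem_filter.1 hx).2
  exact this.commute m x.2

lemma ev_mem_starGroup {i : ZMod p} {l : List (ZMod p × ZMod q)}
    (h : ∀ x ∈ l, Near i x.1) : ev l ∈ starGroup p q i :=
  Subgroup.list_prod_mem _ fun y hy => by
    obtain ⟨x, hx, rfl⟩ := List.mem_map.1 hy
    exact syl_mem_starGroup (Or.inr (h x hx)) _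

/-- Every chamber is spelled by a word whose number of letters is the number of hyperplanes to be
crossed: in a shortest word no hyperplane is crossed twice, because the letters between two
crossings of the same hyperplane could be moved out of the way. -/
lemma exists_geodesic_word (c : Chamber p q) : ∃ l, ev l = c ∧ l.length = len c := by
  obtain ⟨l, rfl⟩ := exists_ev_eq c
  induction hn : l.length using Nat.strong_induction_on generalizing l with
  | _ n ih =>
  by_cases hshort : ∃ l', ev l' = ev l ∧ l'.length < l.length
  · obtain ⟨l', h1, h2⟩ := hshort
    obtain ⟨l'', h3⟩ := ih _ (hn ▸ h2) l' rfl
    exact ⟨l'', by rwa [h1] at h3⟩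
  push Not at hshort
  rcases l with _ | ⟨⟨i, k⟩, l⟩
  · exact ⟨[], by simp⟩
  · refine ⟨_, rfl, ?_⟩
    obtain ⟨l', h1, h2⟩ := ih _ (by rw [← hn]; simp) l rfl
    have hl : l.length = len (ev l) := by
      refine le_antisymm ?_ (len_ev_le l)
      have := hshort ((i, k) :: l') (by simp [h1])
      simpa [h2] using this
    have hk : k ≠ 0 := by
      rintro rfl
      simpa using hshort l (by simp)
    rw [ev_cons, (len_mul_eq_iff _ _).2, len_syl hk, List.length_cons, hl, add_comm]
    intro W hW
    have hW' : W = hyp i 1 := support_syl_subset i k hW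
    subst hW'
    by_contra hne
    rw [smul_hyp, mul_one, ← syl_neg] at hne
    rw [← one_mul (syl i (-k)), hyp_mul_of_mem _ (syl_mem_starGroup (Or.inl rfl) _)] at hne
    -- a second crossing of the same hyperplane could be merged with the first letter
    obtain ⟨l₁, m, l₂, rfl, hl₁⟩ := exists_crossing _ _ _ hne
    rw [mul_one, inv_mem_iff] at hl₁
    obtain ⟨a, ha⟩ := ev_eq_of_mem_starGroup hl₁
    have hle := List.length_filter_le (fun x : ZMod p × ZMod q => Near i x.1) l₁
    have := hshort ((i, k + a + m) :: (l₁.filter (fun x => Near i x.1) ++ l₂)) <| by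
      simp only [ev_cons, ev_append, ha, syl_add]
      simp only [mul_assoc]
      rw [← mul_assoc (ev _) (syl i m), ← (ev_filter_near_commute i m l₁).eq, mul_assoc]
    simp at this
    omega

/-! ### Distances in the tensor network -/

/-- The `i`-th edge of the chamber `c`. -/
def edgeMk (i : ZMod p) (c : Chamber p q) : Edge p q := ⟨i, QuotientGroup.mk c⟩

lemma mem_chambers_mk {i : ZMod p} {c d : Chamber p q} :
    d ∈ (edgeMk i c).chambers ↔ ∃ k : ZMod q, d = c * syl i k := by
  change (QuotientGroup.mk d : Chamber p q ⧸ edgeGroup p q i) = QuotientGroup.mk c ↔ _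
  rw [eq_comm, QuotientGroup.eq, mem_edgeGroup]
  simp only [inv_mul_eq_iff_eq_mul]

lemma exists_edge_eq (e : Edge p q) :
    ∃ (i : ZMod p) (c : Chamber p q), e = edgeMk i c := by
  obtain ⟨i, x⟩ := e
  obtain ⟨c, rfl⟩ := QuotientGroup.mk_surjective x
  exact ⟨i, c, rfl⟩

lemma edge_mk_mul_syl (i : ZMod p) (c : Chamber p q) (k : ZMod q) :
    edgeMk i (c * syl i k) = edgeMk i c :=
  congrArg (Sigma.mk i) (QuotientGroup.eq.2 (by
    rw [mul_inv_rev, inv_mul_cancel_right]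
    exact inv_mem (mem_edgeGroup.2 ⟨k, rfl⟩)))

lemma edge_mk_eq_iff {i j : ZMod p} {c d : Chamber p q} :
    edgeMk i c = edgeMk j d ↔
      i = j ∧ ∃ k : ZMod q, d = c * syl i k := by
  constructor
  · intro h
    have h1 : i = j := congrArg Sigma.fst h
    subst h1
    refine ⟨rfl, mem_chambers_mk.1 ?_⟩
    rw [h]
    exact mem_chambers_mk.2 ⟨0, by simp⟩
  · rintro ⟨rfl, k, rfl⟩
    exact (edge_mk_mul_syl i c k).symm

lemma network_adj_iff {c d : Chamber p q} :
    (network p q).Adj c d ↔ c ≠ d ∧ ∃ (i : ZMod p) (k : ZMod q), d = c * syl i k := by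
  refine and_congr_right fun _ => ⟨?_, ?_⟩
  · rintro ⟨e, hc, hd⟩
    obtain ⟨i, b, rfl⟩ := exists_edge_eq e
    obtain ⟨k, rfl⟩ := mem_chambers_mk.1 hc
    obtain ⟨m, rfl⟩ := mem_chambers_mk.1 hd
    exact ⟨i, m - k, by rw [mul_assoc, ← syl_add, add_sub_cancel]⟩
  · rintro ⟨i, k, rfl⟩
    exact ⟨edgeMk i c, mem_chambers_mk.2 ⟨0, by simp⟩, mem_chambers_mk.2 ⟨k, rfl⟩⟩

lemma exists_walk_of_word (c : Chamber p q) (l : List (ZMod p × ZMod q)) :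
    ∃ w : (network p q).Walk c (c * ev l), w.length ≤ l.length := by
  induction l generalizing c with
  | nil =>
    refine ⟨SimpleGraph.Walk.nil.copy rfl (by simp), ?_⟩
    rw [SimpleGraph.Walk.length_copy, SimpleGraph.Walk.length_nil, List.length_nil]
  | cons x l ih =>
    obtain ⟨w, hw⟩ := ih (c * syl x.1 x.2)
    have he : c * syl x.1 x.2 * ev l = c * ev (x :: l) := by rw [ev_cons, mul_assoc]
    by_cases h : c = c * syl x.1 x.2
    · refine ⟨w.copy h.symm he, ?_⟩
      simp only [SimpleGraph.Walk.length_copy, List.length_cons]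
      omega
    · refine ⟨(SimpleGraph.Walk.cons (network_adj_iff.2 ⟨h, x.1, x.2, rfl⟩) w).copy rfl he, ?_⟩
      simpa using hw

lemma len_le_walk_length {c d : Chamber p q} (w : (network p q).Walk c d) :
    len (c⁻¹ * d) ≤ w.length := by
  induction w with
  | nil => simp
  | @cons a b d hab w ih =>
    obtain ⟨_, i, k, rfl⟩ := network_adj_iff.1 hab
    have h := len_mul_le (syl i k) ((a * syl i k)⁻¹ * d)
    have h' := len_syl_le i k
    have he : syl i k * ((a * syl i k)⁻¹ * d) = a⁻¹ * d := by group
    rw [he] at h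
    rw [SimpleGraph.Walk.length_cons]
    omega

/-- The distance of two chambers is the number of hyperplanes that separate them. -/
lemma network_dist (c d : Chamber p q) : (network p q).dist c d = len (c⁻¹ * d) := by
  obtain ⟨l, h1, h2⟩ := exists_geodesic_word (c⁻¹ * d)
  obtain ⟨w, hw⟩ := exists_walk_of_word c l
  have he : c * ev l = d := by rw [h1, mul_inv_cancel_left]
  refine le_antisymm ?_ ?_
  · have := SimpleGraph.dist_le (w.copy rfl he)
    rw [SimpleGraph.Walk.length_copy] at this
    omega
  · obtain ⟨w', hw'⟩ := (w.copy rfl he).reachable.exists_walk_length_eq_dist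
    rw [← hw']
    exact len_le_walk_length w'

/-! ### Geodesics that leave a hyperplane behind -/

/-- If a geodesic crosses the hyperplane `W` before it reaches `z`, and ends next to `W`, then it
runs along `W` from `z` on. -/
lemma near_of_coord_ne_zero {z : Chamber p q} {l : List (ZMod p × ZMod q)} {i : ZMod p}
    (hlen : len (z * ev l) = len z + l.length) (hW : coord z (hyp i (z * ev l)) ≠ 0) :
    ∀ x ∈ l, Near i x.1 := by
  obtain ⟨lz, rfl, hlz⟩ := exists_geodesic_word z
  -- after the letter that crosses the hyperplane, the word stays in the star group
  obtain ⟨l₁, m, l₂, rfl, hl₁⟩ := exists_crossing _ _ _ hW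
  have hmem : ev (l₂ ++ l) ∈ starGroup p q i := by
    have h := (starGroup p q i).mul_mem
      (syl_mem_starGroup (p := p) (q := q) (i := i) (j := i) (Or.inl rfl) (-m)) hl₁
    have he : syl i (-m) * ((ev l₁)⁻¹ * (ev (l₁ ++ (i, m) :: l₂) * ev l)) = ev (l₂ ++ l) := by
      simp only [ev_append, ev_cons, syl_neg]
      group
    rwa [he] at h
  obtain ⟨a, ha⟩ := ev_eq_of_mem_starGroup hmem
  have heq : ev (l₁ ++ (i, m) :: l₂) * ev l =
      ev (l₁ ++ (i, m + a) :: (l₂ ++ l).filter fun x => Near i x.1) := by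
    simp only [ev_append, ev_cons, syl_add, mul_assoc] at ha ⊢
    rw [ha]
  -- by minimality of the whole word, the filter removes no letter
  have hle := len_ev_le (l₁ ++ (i, m + a) :: (l₂ ++ l).filter fun x => Near i x.1)
  rw [← heq, hlen, ← hlz] at hle
  simp only [List.length_append, List.length_cons] at hle
  have hfil : ((l₂ ++ l).filter fun x => Near i x.1) = l₂ ++ l := by
    refine List.Sublist.eq_of_length_le List.filter_sublist ?_
    rw [List.length_append]
    omega
  intro x hx
  have := List.filter_eq_self.1 hfil x (List.mem_append_right _ hx)
  simpa using this

/-- The types of the last syllables of the reduced words for `z`: the hyperplane of the `i`-th edge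
of `z` separates `z` from the base chamber. -/
def IsLast (z : Chamber p q) (i : ZMod p) : Prop := coord z (hyp i z) ≠ 0

/-- The last syllables of the reduced words for `z` commute: if the syllable of type `i` is put at
the end, the hyperplane of type `j` is crossed before it, and the final letter runs along that
hyperplane. -/
lemma IsLast.near {z : Chamber p q} {i j : ZMod p} (hi : IsLast z i) (hj : IsLast z j)
    (hij : i ≠ j) : Near i j := by
  set k := coord z (hyp i z) with hk
  have hk0 : k ≠ 0 := hi
  have hz : z * syl i (-k) * syl i k = z := by rw [mul_assoc, ← syl_add]; simp
  have hy : hyp i (z * syl i (-k)) = hyp i z :=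
    hyp_mul_of_mem _ (syl_mem_starGroup (Or.inl rfl) _)
  have hc : coord (z * syl i (-k)) (hyp i z) = 0 := by rw [coord_mul_syl_self, ← hk]; ring
  have h := near_of_coord_ne_zero (z := z * syl i (-k)) (l := [(i, k)]) (i := j) ?_ ?_
  · exact (h _ (List.mem_singleton_self _)).symm
  · have := (len_mul_eq_iff (z * syl i (-k)) (syl i k)).2 fun W hW => by
      refine coord_syl_of_ne (fun h => hW ?_) k
      rw [inv_smul_eq_iff, smul_hyp, mul_one, hy] at h
      rw [h, hc]
    rw [len_syl hk0] at this
    simpa using this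
  · simp only [ev_cons, ev_nil, mul_one, hz]
    rw [coord_mul_syl_of_ne]
    · exact hj
    · exact fun h => hij (hyp_eq_iff.1 h).1.symm

/-- A geodesic to `z` extends by a geodesic word for `w` if and only if `w` does not begin with a
syllable whose type is that of a last syllable of `z`. -/
lemma len_mul_eq_iff_isLast (z w : Chamber p q) :
    len (z * w) = len z + len w ↔ ∀ i, IsLast z i → coord w (hyp i 1) = 0 := by
  constructor
  · intro h i hi
    have := (len_mul_eq_iff z w).1 h _ hi
    rwa [smul_hyp, inv_mul_cancel] at this
  · obtain ⟨l, rfl, hl⟩ := exists_geodesic_word w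
    intro h
    rw [← hl]
    induction l using List.reverseRecOn with
    | nil => simp
    | append_singleton l x ih =>
      obtain ⟨i, k⟩ := x
      have hev : ev (l ++ [(i, k)]) = ev l * syl i k := by simp
      have h1 := len_mul_le (ev l) (syl i k)
      have h2 := len_syl_le i k
      have h3 := len_ev_le l
      rw [hev, List.length_append, List.length_singleton] at hl
      have hl' : l.length = len (ev l) := by omega
      have hk : len (syl i k) = 1 := by omega
      have hk0 : k ≠ 0 := by rintro rfl; simp at hk
      have hadd : len (ev l * syl i k) = len (ev l) + len (syl i k) := by omega
      have hdis := (len_mul_eq_iff _ _).1 hadd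
      rw [hev] at h ⊢
      -- the hyperplane crossed by the last letter is not crossed by the word before it
      have hnew : coord (ev l) (hyp i (ev l)) = 0 := by
        by_contra hne
        have := hdis _ hne
        rw [smul_hyp, inv_mul_cancel, coord_syl_self] at this
        exact hk0 this
      have ihl := ih hl' <| by
        intro j hj
        have h0 := h j hj
        by_cases he : hyp j 1 = hyp i (ev l)
        · rw [he, hnew]
        · rwa [coord_mul_syl_of_ne he] at h0
      have hz : coord z (hyp i (z * ev l)) = 0 := by
        by_contra hne
        have hmem := ev_mem_starGroup (near_of_coord_ne_zero ihl hne)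
        have hlast : IsLast z i := by rwa [hyp_mul_of_mem _ hmem] at hne
        have h0 := h i hlast
        have he : hyp i (ev l) = hyp i 1 := by
          conv_lhs => rw [← one_mul (ev l), hyp_mul_of_mem _ hmem]
        rw [← he, coord_mul_syl_self, hnew, zero_add] at h0
        exact hk0 h0
      have hznew : coord (z * ev l) (hyp i (z * ev l)) = 0 := by
        rw [coord_mul, hz, smul_hyp, inv_mul_cancel_left, hnew, zero_add]
      rw [← mul_assoc, (len_mul_eq_iff _ _).2, hk, ihl, List.length_append, List.length_singleton,
        add_assoc]
      intro W hW
      refine coord_syl_of_ne (fun h => hW ?_) k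
      rw [inv_smul_eq_iff, smul_hyp, mul_one] at h
      rw [h, hznew]

/-! ### Cyclic indices -/

lemma natCast_zmod_ne_zero (hp : 5 ≤ p) {n : ℕ} (h0 : 0 < n) (h : n < 5) : (n : ZMod p) ≠ 0 := by
  rw [Ne, ZMod.natCast_eq_zero_iff]
  exact fun hd => absurd (Nat.le_of_dvd h0 hd) (by omega)

lemma not_near_self (hp : 5 ≤ p) (i : ZMod p) : ¬ Near i i := by
  have h1 := natCast_zmod_ne_zero hp (n := 1) (by norm_num) (by norm_num)
  rintro (h | h)
  · exact h1 (by push_cast; linear_combination h)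
  · exact h1 (by push_cast; linear_combination -h)

lemma sub_one_ne_add_one (hp : 5 ≤ p) (i : ZMod p) : i - 1 ≠ i + 1 := fun h =>
  natCast_zmod_ne_zero hp (n := 2) (by norm_num) (by norm_num) (by
    push_cast; linear_combination -h)

lemma not_near_sub_one_add_one (hp : 5 ≤ p) (i : ZMod p) : ¬ Near (i - 1) (i + 1) := by
  rintro (h | h)
  · exact natCast_zmod_ne_zero hp (n := 3) (by norm_num) (by norm_num) (by
      push_cast; linear_combination h)
  · exact natCast_zmod_ne_zero hp (n := 1) (by norm_num) (by norm_num) (by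
      push_cast; linear_combination h)

lemma eq_or_eq_of_isLast (hp : 5 ≤ p) {z : Chamber p q} {i j : ZMod p} (hi : IsLast z i)
    (hi' : IsLast z (i + 1)) (hj : IsLast z j) : j = i ∨ j = i + 1 := by
  by_contra! h
  have h1 := hi.near hj (Ne.symm h.1)
  have h2 := hi'.near hj (Ne.symm h.2)
  rcases h1 with rfl | rfl
  · exact not_near_sub_one_add_one hp i h2.symm
  · exact h.2 rfl

lemma exists_not_isLast (hp : 5 ≤ p) (c : Chamber p q) : ∃ i, ¬ IsLast c i := by
  by_contra! h
  exact not_near_sub_one_add_one hp 0 ((h _).near (h _) (sub_one_ne_add_one hp 0))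

/-! ### The ball entanglement wedge and its boundary -/

lemma one_zmod_ne_zero (hq : 3 ≤ q) : (1 : ZMod q) ≠ 0 := by
  have : Fact (1 < q) := ⟨by omega⟩
  exact one_ne_zero

lemma len_mul_syl {c : Chamber p q} {i : ZMod p} (hi : ¬ IsLast c i) {k : ZMod q} (hk : k ≠ 0) :
    len (c * syl i k) = len c + 1 := by
  rw [(len_mul_eq_iff_isLast _ _).2, len_syl hk]
  intro j hj
  refine coord_syl_of_ne (fun h => hi ?_) k
  rwa [(hyp_eq_iff.1 h).1] at hj

/-- A finite geodesic from the base chamber extends to a semi-infinite one. -/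
lemma exists_ray (hp : 5 ≤ p) (hq : 3 ≤ q) (l : List (ZMod p × ZMod q))
    (hl : l.length = len (ev l)) :
    ∃ x : ℕ → Chamber p q, (∀ n ≤ l.length, x n = ev (l.take n)) ∧ (∀ n, len (x n) = n) ∧
      ∀ n, len ((x n)⁻¹ * x (n + 1)) ≤ 1 := by
  choose f hf using fun c : Chamber p q => exists_not_isLast hp c
  let x : ℕ → Chamber p q := fun n => Nat.rec 1 (fun n c =>
    match l[n]? with
    | some a => c * syl a.1 a.2
    | none => c * syl (f c) 1) n
  have hx1 : ∀ n (h : n < l.length), x (n + 1) = x n * syl l[n].1 l[n].2 := by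
    intro n h
    change (match l[n]? with
      | some a => x n * syl a.1 a.2
      | none => x n * syl (f (x n)) 1) = _
    rw [List.getElem?_eq_getElem h]
  have hx2 : ∀ n, l.length ≤ n → x (n + 1) = x n * syl (f (x n)) 1 := by
    intro n h
    change (match l[n]? with
      | some a => x n * syl a.1 a.2
      | none => x n * syl (f (x n)) 1) = _
    rw [List.getElem?_eq_none h]
  have htake : ∀ n ≤ l.length, x n = ev (l.take n) := by
    intro n
    induction n with
    | zero => intro _; simp [x]
    | succ n ih =>
      intro h
      rw [hx1 n h, ih (by omega), List.take_succ_eq_append_getElem h, ev_append, ev_cons,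
        ev_nil, mul_one]
  refine ⟨x, htake, ?_, ?_⟩
  · intro n
    induction n with
    | zero => simp [x]
    | succ n ih =>
      rcases lt_or_ge n l.length with h | h
      · have h1 := len_mul_le (ev (l.take (n + 1))) (ev (l.drop (n + 1)))
        rw [← ev_append, List.take_append_drop, ← hl] at h1
        have h2 := len_ev_le (l.take (n + 1))
        have h3 := len_ev_le (l.drop (n + 1))
        rw [List.length_take] at h2
        rw [List.length_drop] at h3
        rw [htake (n + 1) h]
        omega
      · rw [hx2 n h, len_mul_syl (hf _) (one_zmod_ne_zero hq), ih]
  · intro n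
    rcases lt_or_ge n l.length with h | h
    · rw [hx1 n h, inv_mul_cancel_left]
      exact len_syl_le _ _
    · rw [hx2 n h, inv_mul_cancel_left]
      exact len_syl_le _ _

lemma isGeodesicRay_of_len (O : Chamber p q) (x : ℕ → Chamber p q) (h1 : ∀ n, len (x n) = n)
    (h2 : ∀ n, len ((x n)⁻¹ * x (n + 1)) ≤ 1) : IsGeodesicRay fun n => O * x n := by
  have h3 : ∀ m k, len ((x m)⁻¹ * x (m + k)) ≤ k := by
    intro m k
    induction k with
    | zero => simp
    | succ k ih =>
      have h := len_mul_le ((x m)⁻¹ * x (m + k)) ((x (m + k))⁻¹ * x (m + k + 1))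
      have h' := h2 (m + k)
      rw [mul_assoc, mul_inv_cancel_left] at h
      rw [← add_assoc]
      omega
  intro m n hmn
  obtain ⟨k, rfl⟩ := Nat.exists_eq_add_of_le hmn
  rw [network_dist, mul_inv_rev, mul_assoc, inv_mul_cancel_left, Nat.add_sub_cancel_left]
  refine le_antisymm (h3 m k) ?_
  have h := len_mul_le (x m) ((x m)⁻¹ * x (m + k))
  rw [mul_inv_cancel_left, h1, h1] at h
  omega

/-- As every geodesic can be prolonged, the ball entanglement wedge consists of the chambers that
are separated from `O` by `z`, in the metric sense. -/
lemma mem_ballWedge_iff (hp : 5 ≤ p) (hq : 3 ≤ q) (O z c : Chamber p q) :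
    c ∈ ballWedge O z ↔ len (O⁻¹ * c) = len (O⁻¹ * z) + len (z⁻¹ * c) := by
  constructor
  · rintro ⟨γ, hγ, rfl, m, rfl, n, hmn, rfl⟩
    rw [← network_dist, ← network_dist, ← network_dist, hγ 0 n (by omega), hγ 0 m (by omega),
      hγ m n hmn]
    omega
  · intro h
    obtain ⟨l, hl, hl'⟩ := exists_geodesic_word (O⁻¹ * z)
    obtain ⟨l', hw, hw'⟩ := exists_geodesic_word (z⁻¹ * c)
    have hlen : (l ++ l').length = len (ev (l ++ l')) := by
      rw [List.length_append, hl', hw', ev_append, hl, hw, ← h]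
      congr 1
      group
    obtain ⟨x, hx, h1, h2⟩ := exists_ray hp hq _ hlen
    refine ⟨_, isGeodesicRay_of_len O x h1 h2, ?_, l.length, ?_, (l ++ l').length, by simp, ?_⟩
    · simp [hx 0]
    · simp [hx l.length, hl]
    · rw [hx _ le_rfl, List.take_length, ev_append, hl, hw]
      group

lemma mul_mem_ballWedge_iff (hp : 5 ≤ p) (hq : 3 ≤ q) (O z w : Chamber p q) :
    O * (z * w) ∈ ballWedge O (O * z) ↔ len (z * w) = len z + len w := by
  rw [mem_ballWedge_iff hp hq]
  have h1 : O⁻¹ * (O * (z * w)) = z * w := by group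
  have h2 : O⁻¹ * (O * z) = z := by group
  have h3 : (O * z)⁻¹ * (O * (z * w)) = w := by group
  rw [h1, h2, h3]

/-- The edge of type `j` on the chamber `O z w`. -/
def edgeAt (O z : Chamber p q) (j : ZMod p) (w : Chamber p q) : Edge p q :=
  edgeMk j (O * (z * w))

lemma mem_edgeAt_chambers {O z : Chamber p q} {j : ZMod p} {w d : Chamber p q} :
    d ∈ (edgeAt O z j w).chambers ↔ ∃ k : ZMod q, d = O * (z * (w * syl j k)) := by
  rw [edgeAt, mem_chambers_mk]
  simp only [mul_assoc]

/-- The words `w` for which `z w`, reached by a geodesic through `z`, is next to the hyperplane of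
the `j`-th edge of `z`. -/
def alongSet (z : Chamber p q) (j : ZMod p) : Set (Chamber p q) :=
  {w | (∃ l, ev l = w ∧ l.length = len w ∧ ∀ x ∈ l, Near j x.1) ∧
    ∀ i, IsLast z i → coord w (hyp i 1) = 0}

lemma hyp_eq_of_mem_alongSet {z w : Chamber p q} {j : ZMod p} (h : w ∈ alongSet z j)
    (c : Chamber p q) : hyp j (c * w) = hyp j c := by
  obtain ⟨⟨l, rfl, _, hl⟩, _⟩ := h
  exact hyp_mul_of_mem _ (ev_mem_starGroup hl)

/-- On an edge of the boundary the wedge has exactly one chamber. -/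
lemma edgeAt_mem_wedge_iff (hp : 5 ≤ p) (hq : 3 ≤ q) (O : Chamber p q) {z w : Chamber p q}
    {j : ZMod p} (hj : IsLast z j) (h : w ∈ alongSet z j) (k : ZMod q) :
    O * (z * (w * syl j k)) ∈ ballWedge O (O * z) ↔ k = 0 := by
  rw [mul_mem_ballWedge_iff hp hq, len_mul_eq_iff_isLast]
  have hw : hyp j w = hyp j 1 := by simpa using hyp_eq_of_mem_alongSet h 1
  constructor
  · intro h'
    have h1 := h' j hj
    rw [← hw, coord_mul_syl_self, hw, h.2 j hj, zero_add] at h1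
    exact h1
  · rintro rfl
    simpa using h.2

lemma len_of_mem_alongSet {z w : Chamber p q} {j : ZMod p} (h : w ∈ alongSet z j) :
    len (z * w) = len z + len w :=
  (len_mul_eq_iff_isLast z w).2 h.2

lemma isLast_mul_of_mem_alongSet {z w : Chamber p q} {j : ZMod p} (hj : IsLast z j)
    (h : w ∈ alongSet z j) : IsLast (z * w) j := by
  have := (len_mul_eq_iff z w).1 (len_of_mem_alongSet h) _ hj
  rw [IsLast, hyp_eq_of_mem_alongSet h, coord_mul, this, add_zero]
  exact hj

lemma mem_boundaryEdges_iff (hp : 5 ≤ p) (hq : 3 ≤ q) (O z : Chamber p q) (e : Edge p q) :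
    e ∈ boundaryEdges (ballWedge O (O * z)) ↔
      ∃ j, IsLast z j ∧ ∃ w ∈ alongSet z j, e = edgeAt O z j w := by
  constructor
  · rintro ⟨⟨c, hc, hcR⟩, ⟨d, hd, hdR⟩⟩
    obtain ⟨w, rfl⟩ : ∃ w, c = O * (z * w) := ⟨z⁻¹ * (O⁻¹ * c), by group⟩
    obtain ⟨j, b, rfl⟩ := exists_edge_eq e
    obtain ⟨k', hk'⟩ := mem_chambers_mk.1 hc
    have he : edgeMk j b = edgeAt O z j w := by
      rw [edgeAt, hk', edge_mk_mul_syl]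
    rw [he] at hd ⊢
    obtain ⟨k, rfl⟩ := mem_edgeAt_chambers.1 hd
    rw [mul_mem_ballWedge_iff hp hq] at hcR
    have hdis := (len_mul_eq_iff_isLast z w).1 hcR
    rw [Set.mem_compl_iff, mul_mem_ballWedge_iff hp hq, len_mul_eq_iff_isLast] at hdR
    push Not at hdR
    obtain ⟨i, hi, hne⟩ := hdR
    have hij : hyp i 1 = hyp j w := by
      by_contra h
      rw [coord_mul_syl_of_ne h, hdis i hi] at hne
      exact hne rfl
    obtain ⟨rfl, hmem⟩ := hyp_eq_iff.1 hij
    obtain ⟨l, rfl, hl⟩ := exists_geodesic_word w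
    refine ⟨i, hi, _, ⟨⟨l, rfl, hl, ?_⟩, hdis⟩, rfl⟩
    refine near_of_coord_ne_zero (by rw [hcR, hl]) ?_
    rw [hyp_mul_of_mem _ (by simpa using hmem)]
    exact hi
  · rintro ⟨j, hj, w, hw, rfl⟩
    refine ⟨⟨_, mem_edgeAt_chambers.2 ⟨0, rfl⟩, (edgeAt_mem_wedge_iff hp hq O hj hw 0).2 rfl⟩,
      ⟨_, mem_edgeAt_chambers.2 ⟨1, rfl⟩, fun h => ?_⟩⟩
    exact one_zmod_ne_zero hq ((edgeAt_mem_wedge_iff hp hq O hj hw 1).1 h)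

lemma edgeLayer_edgeAt {O z w : Chamber p q} {j : ZMod p} (hj : IsLast z j)
    (h : w ∈ alongSet z j) : edgeLayer O (edgeAt O z j w) + 1 = len z + len w := by
  have hlast := isLast_mul_of_mem_alongSet hj h
  set k := coord (z * w) (hyp j (z * w)) with hk
  have hk0 : k ≠ 0 := hlast
  set y := z * w * syl j (-k) with hy
  have hyw : z * w = y * syl j k := by rw [hy, mul_assoc, ← syl_add]; simp
  have hhy : hyp j y = hyp j (z * w) := hyp_mul_of_mem _ (syl_mem_starGroup (Or.inl rfl) _)
  have hny : ¬ IsLast y j := by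
    rw [IsLast, not_not, hhy, hy, coord_mul_syl_self, ← hk, add_neg_cancel]
  have hlen : len y + 1 = len z + len w := by
    rw [← len_of_mem_alongSet h, hyw, len_mul_syl hny hk0]
  have hlayer : edgeLayer O (edgeAt O z j w) = len y := by
    refine le_antisymm (Nat.sInf_le ⟨O * y, ?_, ?_⟩) (le_csInf ⟨_, O * y, ?_, rfl⟩ ?_)
    · exact mem_edgeAt_chambers.2 ⟨-k, by rw [hy, mul_assoc]⟩
    · rw [network_dist, inv_mul_cancel_left]
    · exact mem_edgeAt_chambers.2 ⟨-k, by rw [hy, mul_assoc]⟩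
    · rintro n ⟨c, hc, rfl⟩
      obtain ⟨m, rfl⟩ := mem_edgeAt_chambers.1 hc
      rw [network_dist, inv_mul_cancel_left, ← mul_assoc, hyw, mul_assoc, ← syl_add]
      by_cases h0 : k + m = 0
      · rw [h0, syl_zero, mul_one]
      · rw [len_mul_syl hny h0]
        omega
  omega

lemma edgeAt_injOn (hp : 5 ≤ p) (hq : 3 ≤ q) (O : Chamber p q) {z : Chamber p q} {j : ZMod p}
    (hj : IsLast z j) : Set.InjOn (edgeAt O z j) (alongSet z j) := by
  intro w hw w' hw' he
  have h0 := (edgeAt_mem_wedge_iff hp hq O hj hw' 0).2 rfl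
  have hc : O * (z * (w' * syl j 0)) ∈ (edgeAt O z j w).chambers := by
    rw [he]
    exact mem_edgeAt_chambers.2 ⟨0, rfl⟩
  obtain ⟨k, hk⟩ := mem_edgeAt_chambers.1 hc
  rw [hk, edgeAt_mem_wedge_iff hp hq O hj hw] at h0
  subst h0
  simpa using hk.symm

/-! ### Counting reduced words in two non-adjacent generators -/

/-- The reduced words in the syllables of two given types that do not begin with a
syllable of type `a`, and have at most `n` letters. -/
def wordBall (q : ℕ) (a b : ZMod p) (n : ℕ) : Set (Chamber p q) :=
  {w | (∃ l, ev l = w ∧ l.length = len w ∧ ∀ x ∈ l, x.1 = a ∨ x.1 = b) ∧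
    len w ≤ n ∧ coord w (hyp a 1) = 0}

lemma isLast_inv_iff {w : Chamber p q} {a : ZMod p} :
    IsLast w⁻¹ a ↔ coord w (hyp a 1) ≠ 0 := by
  rw [IsLast, coord_inv, smul_hyp, mul_inv_cancel, neg_ne_zero]

/-- A word cannot begin both with `s_a` and with `s_b`, unless these commute. -/
lemma eq_zero_or_eq_zero {w : Chamber p q} {a b : ZMod p} (hab : a ≠ b) (hn : ¬ Near a b) :
    coord w (hyp a 1) = 0 ∨ coord w (hyp b 1) = 0 := by
  by_contra! h
  exact hn ((isLast_inv_iff.2 h.1).near (isLast_inv_iff.2 h.2) hab)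

lemma coord_ev_eq_zero {l : List (ZMod p × ZMod q)} {i : ZMod p} (h : ∀ x ∈ l, x.1 ≠ i)
    (c : Chamber p q) : coord (ev l) (hyp i c) = 0 := by
  by_contra hne
  obtain ⟨l₁, m, l₂, rfl, _⟩ := exists_crossing _ _ _ hne
  exact h (i, m) (by simp) rfl

lemma hyp_one_eq_iff {i j : ZMod p} : (hyp i 1 : Hyperplane p q) = hyp j 1 ↔ i = j := by
  rw [hyp_eq_iff]
  simp

lemma coord_syl_mul_self (b : ZMod p) (k : ZMod q) (w : Chamber p q) :
    coord (syl b k * w) (hyp b 1) = k + coord w (hyp b 1) := by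
  rw [coord_mul, coord_syl_self, smul_hyp, mul_one, ← syl_neg]
  conv_lhs => rw [← one_mul (syl b (-k)), hyp_mul_of_mem _ (syl_mem_starGroup (Or.inl rfl) _)]

lemma len_syl_mul {b : ZMod p} {k : ZMod q} (hk : k ≠ 0) {w : Chamber p q}
    (hw : coord w (hyp b 1) = 0) : len (syl b k * w) = len w + 1 := by
  rw [(len_mul_eq_iff _ _).2, len_syl hk, add_comm]
  intro W hW
  have hW' : W = hyp b 1 := support_syl_subset b k hW
  subst hW'
  have := coord_mul (syl b k) w (hyp b 1)
  rw [coord_syl_mul_self, coord_syl_self, hw] at this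
  exact (add_left_cancel this).symm

lemma geodesic_cons {x : ZMod p × ZMod q} {l : List (ZMod p × ZMod q)}
    (h : (x :: l).length = len (ev (x :: l))) :
    x.2 ≠ 0 ∧ l.length = len (ev l) ∧ coord (ev l) (hyp x.1 1) = 0 := by
  have h1 := len_ev_le l
  have h2 := len_syl_le x.1 x.2
  have h3 := len_mul_le (syl x.1 x.2) (ev l)
  rw [ev_cons, List.length_cons] at h
  have hx : x.2 ≠ 0 := by
    intro h0
    rw [h0, syl_zero, one_mul] at h
    omega
  refine ⟨hx, by omega, ?_⟩
  have h4 := (len_mul_eq_iff (syl x.1 x.2) (ev l)).1 (by omega) (hyp x.1 1) (by simpa using hx)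
  have h5 := coord_mul (syl x.1 x.2) (ev l) (hyp x.1 1)
  rw [h4, coord_syl_mul_self, coord_syl_self] at h5
  exact add_left_cancel h5

lemma one_mem_wordBall (a b : ZMod p) (n : ℕ) : (1 : Chamber p q) ∈ wordBall q a b n :=
  ⟨⟨[], by simp⟩, by simp, by simp⟩

/-- A nontrivial reduced word in `s_a` and `s_b` that does not begin with `s_a` begins with `s_b`;
the rest of it does not begin with `s_b`. -/
lemma wordBall_succ {a b : ZMod p} (hab : a ≠ b) (hn : ¬ Near a b) (n : ℕ) :
    wordBall q a b (n + 1) = insert 1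
      ((fun x : ZMod q × Chamber p q => syl b x.1 * x.2) '' ({0}ᶜ ×ˢ wordBall q b a n)) := by
  ext w
  constructor
  · rintro ⟨⟨l, rfl, hl, hab'⟩, hlen, h0⟩
    rcases l with _ | ⟨⟨i, k⟩, l⟩
    · exact Or.inl rfl
    · obtain ⟨hk, hl', h1⟩ := geodesic_cons hl
      have hi : i = b := by
        rcases hab' _ List.mem_cons_self with h | h
        · change i = a at h
          subst h
          rw [ev_cons, coord_syl_mul_self, h1, add_zero] at h0
          exact absurd h0 hk
        · exact h
      subst hi
      refine Or.inr ⟨(k, ev l), ⟨hk, ⟨l, rfl, hl', fun x hx => ?_⟩, ?_, h1⟩, rfl⟩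
      · exact (hab' x (List.mem_cons_of_mem _ hx)).symm
      · rw [← hl, List.length_cons] at hlen
        change len (ev l) ≤ n
        omega
  · rintro (rfl | ⟨⟨k, w⟩, ⟨hk, ⟨l, rfl, hl, hab'⟩, hlen, h0⟩, rfl⟩)
    · exact one_mem_wordBall a b _
    · replace hk : k ≠ 0 := hk
      have hl' := len_syl_mul hk h0
      refine ⟨⟨(b, k) :: l, by simp, by simp [hl', hl], ?_⟩, by simpa [hl'] using hlen, ?_⟩
      · intro x hx
        rcases List.mem_cons.1 hx with rfl | hx
        · exact Or.inr rfl
        · exact (hab' x hx).symm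
      · refine (eq_zero_or_eq_zero hab hn).resolve_right ?_
        change coord (syl b k * ev l) _ ≠ 0
        rwa [coord_syl_mul_self, h0, add_zero]

lemma wordBall_zero (a b : ZMod p) : wordBall q a b 0 = {1} := by
  refine Set.eq_singleton_iff_unique_mem.2 ⟨one_mem_wordBall a b 0, ?_⟩
  rintro _ ⟨⟨l, rfl, hl, _⟩, hlen, _⟩
  rw [← hl, Nat.le_zero, List.length_eq_zero_iff] at hlen
  rw [hlen, ev_nil]

lemma finite_len_le (hp : 5 ≤ p) (hq : 3 ≤ q) (n : ℕ) : {w : Chamber p q | len w ≤ n}.Finite := by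
  have : NeZero p := ⟨by omega⟩
  have : NeZero q := ⟨by omega⟩
  refine ((List.finite_length_le (ZMod p × ZMod q) n).image ev).subset ?_
  intro w (hw : len w ≤ n)
  obtain ⟨l, rfl, hl⟩ := exists_geodesic_word w
  exact ⟨l, hl.trans_le hw, rfl⟩

lemma finite_wordBall (hp : 5 ≤ p) (hq : 3 ≤ q) (a b : ZMod p) (n : ℕ) :
    (wordBall q a b n).Finite :=
  (finite_len_le hp hq n).subset fun _ h => h.2.1

lemma ncard_wordBall (hp : 5 ≤ p) (hq : 3 ≤ q) {a b : ZMod p} (hab : a ≠ b) (hn : ¬ Near a b)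
    (n : ℕ) : (wordBall q a b n).ncard = ∑ m ∈ Finset.range (n + 1), (q - 1) ^ m := by
  have : NeZero q := ⟨by omega⟩
  induction n generalizing a b with
  | zero => simp [wordBall_zero]
  | succ n ih =>
    have hfin := ((Set.toFinite ({0}ᶜ : Set (ZMod q))).prod (finite_wordBall hp hq b a n)).image
      fun x : ZMod q × Chamber p q => syl b x.1 * x.2
    rw [wordBall_succ hab hn, Set.ncard_insert_of_notMem ?_ hfin, Set.InjOn.ncard_image,
      Set.ncard_prod, ih hab.symm fun h => hn h.symm, Set.ncard_compl, Set.ncard_singleton,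
      Nat.card_zmod, Finset.sum_range_succ' _ (n + 1), Finset.mul_sum]
    · simp only [pow_succ', pow_zero]
    · rintro ⟨k, w⟩ ⟨_, hw⟩ ⟨k', w'⟩ ⟨_, hw'⟩ h
      change syl b k * w = syl b k' * w' at h
      have hk := congrArg (fun c => coord c (hyp b 1)) h
      simp only [coord_syl_mul_self, hw.2.2, hw'.2.2, add_zero] at hk
      subst hk
      rw [mul_left_cancel h]
    · rintro ⟨⟨k, w⟩, ⟨hk, hw⟩, h⟩
      have h' := congrArg (fun c => coord c (hyp b 1)) h
      simp only [coord_syl_mul_self, hw.2.2, add_zero, coord_one] at h'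
      exact hk h'

lemma wordBall_inter {a b : ZMod p} (n : ℕ) : wordBall q a b n ∩ wordBall q b a n = {1} := by
  refine Set.eq_singleton_iff_unique_mem.2
    ⟨⟨one_mem_wordBall a b n, one_mem_wordBall b a n⟩, ?_⟩
  rintro w ⟨⟨⟨l, rfl, hl, hab⟩, _, ha⟩, ⟨_, _, hb⟩⟩
  rcases l with _ | ⟨x, l⟩
  · rfl
  · obtain ⟨hk, -, h1⟩ := geodesic_cons hl
    have h2 := coord_syl_mul_self x.1 x.2 (ev l)
    rw [h1, add_zero, ← ev_cons] at h2
    rcases hab _ List.mem_cons_self with h | h <;> rw [h] at h2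
    · exact absurd (h2.symm.trans ha) hk
    · exact absurd (h2.symm.trans hb) hk

/-- If `j` is the only type of a last syllable of `z`, the words to be counted are all reduced
words in the two generators adjacent to `s_j`. -/
lemma alongSet_eq_of_single (hp : 5 ≤ p) {z : Chamber p q} {j : ZMod p}
    (hz : ∀ i, IsLast z i ↔ i = j) (n : ℕ) :
    alongSet z j ∩ {w | len w ≤ n} =
      wordBall q (j - 1) (j + 1) n ∪ wordBall q (j + 1) (j - 1) n := by
  ext w
  constructor
  · rintro ⟨⟨⟨l, rfl, hl, hj⟩, _⟩, hn⟩
    rcases eq_zero_or_eq_zero (w := ev l) (sub_one_ne_add_one hp j)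
      (not_near_sub_one_add_one hp j) with h | h
    · exact Or.inl ⟨⟨l, rfl, hl, hj⟩, hn, h⟩
    · exact Or.inr ⟨⟨l, rfl, hl, fun x hx => Or.symm (hj x hx)⟩, hn, h⟩
  · have key : ∀ l : List (ZMod p × ZMod q), (∀ x ∈ l, Near j x.1) →
        ∀ i, IsLast z i → coord (ev l) (hyp i 1) = 0 := by
      intro l hj i hi
      rw [(hz i).1 hi]
      exact coord_ev_eq_zero (fun x hx h => not_near_self hp j (by simpa [h] using hj x hx)) 1
    rintro (⟨⟨l, rfl, hl, hj⟩, hn, _⟩ | ⟨⟨l, rfl, hl, hj⟩, hn, _⟩)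
    · exact ⟨⟨⟨l, rfl, hl, hj⟩, key l hj⟩, hn⟩
    · have hj' : ∀ x ∈ l, Near j x.1 := fun x hx => Or.symm (hj x hx)
      exact ⟨⟨⟨l, rfl, hl, hj'⟩, key l hj'⟩, hn⟩

/-- If the last syllables of `z` have the two types `j` and `a`, the words to be counted next to
the `j`-th edge of `z` must not begin with `s_a`. -/
lemma alongSet_eq_of_pair (hp : 5 ≤ p) {z : Chamber p q} {j a b : ZMod p}
    (hz : ∀ i, IsLast z i ↔ i = j ∨ i = a) (hab : ∀ x, Near j x ↔ x = a ∨ x = b) (n : ℕ) :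
    alongSet z j ∩ {w | len w ≤ n} = wordBall q a b n := by
  ext w
  constructor
  · rintro ⟨⟨⟨l, rfl, hl, hj⟩, h0⟩, hn⟩
    exact ⟨⟨l, rfl, hl, fun x hx => (hab _).1 (hj x hx)⟩, hn, h0 a ((hz a).2 (Or.inr rfl))⟩
  · rintro ⟨⟨l, rfl, hl, hj⟩, hn, h0⟩
    refine ⟨⟨⟨l, rfl, hl, fun x hx => (hab _).2 (hj x hx)⟩, fun i hi => ?_⟩, hn⟩
    rcases (hz i).1 hi with rfl | rfl
    · refine coord_ev_eq_zero (fun x hx h => not_near_self hp i ?_) 1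
      simpa [h] using (hab _).2 (hj x hx)
    · exact h0

lemma cast_sum_pow (hq : 3 ≤ q) (n : ℕ) :
    2 * ((∑ m ∈ Finset.range (n + 1), (q - 1) ^ m : ℕ) : ℝ) =
      2 / ((q : ℝ) - 2) * (((q : ℝ) - 1) ^ (n + 1) - 1) := by
  have h3 : (3 : ℝ) ≤ q := by exact_mod_cast hq
  have h1 : ((q - 1 : ℕ) : ℝ) = (q : ℝ) - 1 := by
    rw [Nat.cast_sub (by omega), Nat.cast_one]
  push_cast
  rw [h1, geom_sum_eq (by linarith), show (q : ℝ) - 1 - 1 = q - 2 by ring]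
  ring

/-! ### Walls: constant type and existence -/

lemma mem_vertexGroup {i : ZMod p} {c : Chamber p q} (h : c ∈ vertexGroup p q i) :
    ∃ a b : ZMod q, c = syl i a * syl (i + 1) b := by
  have hc : ∀ a b : ZMod q, Commute (syl i a) (syl (i + 1) b) :=
    fun a b => Near.commute (Or.inr rfl) a b
  induction h using Subgroup.closure_induction with
  | mem x hx =>
    rcases hx with rfl | rfl
    · exact ⟨1, 0, by simp⟩
    · exact ⟨0, 1, by simp⟩
  | one => exact ⟨0, 0, by simp⟩
  | mul x y _ _ hx hy =>
    obtain ⟨a, b, rfl⟩ := hx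
    obtain ⟨a', b', rfl⟩ := hy
    refine ⟨a + a', b + b', ?_⟩
    rw [syl_add, syl_add, mul_assoc, ← mul_assoc (syl (i + 1) b), ← (hc a' b).eq]
    simp only [mul_assoc]
  | inv x _ hx =>
    obtain ⟨a, b, rfl⟩ := hx
    exact ⟨-a, -b, by rw [mul_inv_rev, syl_neg, syl_neg, ← syl_neg, ← syl_neg, (hc _ _).eq]⟩

lemma syl_left_mem_vertexGroup (i : ZMod p) (k : ZMod q) : syl i k ∈ vertexGroup p q i := by
  obtain ⟨n, rfl⟩ := ZMod.intCast_surjective k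
  rw [syl_intCast]
  exact (vertexGroup p q i).zpow_mem (Subgroup.subset_closure (Or.inl rfl)) n

lemma syl_right_mem_vertexGroup (i : ZMod p) (k : ZMod q) :
    syl (i + 1) k ∈ vertexGroup p q i := by
  obtain ⟨n, rfl⟩ := ZMod.intCast_surjective k
  rw [syl_intCast]
  exact (vertexGroup p q i).zpow_mem (Subgroup.subset_closure (Or.inr rfl)) n

/-- Two edges of different types at a vertex are sides of a common chamber. -/
lemma exists_common_chamber {v : Vertex p q} {e f : Edge p q} (he : IsEndpoint v e)
    (hf : IsEndpoint v f) (h1 : e.1 = v.1) (h2 : f.1 = v.1 + 1) :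
    (e.chambers ∩ f.chambers).Nonempty := by
  obtain ⟨_, c, hc, hcv⟩ := he
  obtain ⟨_, d, hd, hdv⟩ := hf
  obtain ⟨i, x⟩ := v
  obtain ⟨j, e⟩ := e
  obtain ⟨k, f⟩ := f
  change j = i at h1
  change k = i + 1 at h2
  subst h1 h2
  replace hc : (QuotientGroup.mk c : Chamber p q ⧸ edgeGroup p q j) = e := hc
  replace hd : (QuotientGroup.mk d : Chamber p q ⧸ edgeGroup p q (j + 1)) = f := hd
  subst hc hd
  obtain ⟨a, b, hab⟩ := mem_vertexGroup (QuotientGroup.eq.1 (Eq.trans hcv (Eq.symm hdv)))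
  refine ⟨c * syl j a, mem_chambers_mk.2 ⟨a, rfl⟩, mem_chambers_mk.2 ⟨-b, ?_⟩⟩
  rw [inv_mul_eq_iff_eq_mul.1 hab, syl_neg]
  group

/-- As the links are complete bipartite, a straight edge path does not change type. -/
lemma StraightAt.fst_eq {v : Vertex p q} {e f : Edge p q} (h : StraightAt v e f) : e.1 = f.1 := by
  obtain ⟨he, hf, hd⟩ := h
  by_contra hne
  have hadj : (link v).Adj ⟨e, he⟩ ⟨f, hf⟩ := by
    refine ⟨fun h => hne (congrArg (fun x => x.1.1) h), ?_⟩
    rcases he.1 with h1 | h1 <;> rcases hf.1 with h2 | h2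
    · exact absurd (h1.trans h2.symm) hne
    · exact exists_common_chamber he hf h1 h2
    · rw [Set.inter_comm]
      exact exists_common_chamber hf he h2 h1
    · exact absurd (h1.trans h2.symm) hne
  rw [SimpleGraph.dist_eq_one_iff_adj.2 hadj] at hd
  omega

lemma StraightAt.symm {v : Vertex p q} {e f : Edge p q} (h : StraightAt v e f) :
    StraightAt v f e := by
  obtain ⟨he, hf, hd⟩ := h
  exact ⟨hf, he, by rwa [SimpleGraph.dist_comm]⟩

lemma eq_of_mem_chambers {e f : Edge p q} {c : Chamber p q} (h : e.1 = f.1)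
    (he : c ∈ e.chambers) (hf : c ∈ f.chambers) : e = f := by
  obtain ⟨i, e⟩ := e
  obtain ⟨j, f⟩ := f
  change i = j at h
  subst h
  exact congrArg (Sigma.mk i) (Eq.trans (Eq.symm he) hf)

lemma IsWall.fst_eq {γ : ℤ → Edge p q} (h : IsWall γ) (m n : ℤ) : (γ m).1 = (γ n).1 := by
  obtain ⟨v, hv⟩ := h
  have key : ∀ n, (γ n).1 = (γ 0).1 := by
    intro n
    induction n using Int.induction_on with
    | zero => rfl
    | succ n ih => rw [← (hv n).2.fst_eq, ih]
    | pred n ih => rw [← ih, (hv _).2.fst_eq, sub_add_cancel]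
  rw [key m, key n]

lemma straightAt_of_same_type {v : Vertex p q} {i j : ZMod p} {c : Chamber p q} {k : ZMod q}
    (hi : i = v.1 ∨ i = v.1 + 1) (hj : j = v.1 ∨ j = v.1 + 1) (hij : i ≠ j) (hk : k ≠ 0)
    (hc : c ∈ v.chambers) (hck : c * syl j k ∈ v.chambers) :
    StraightAt v (edgeMk i c) (edgeMk i (c * syl j k)) := by
  have hm : ∀ (i : ZMod p) (c : Chamber p q),
      c ∈ (edgeMk i c).chambers :=
    fun i c => mem_chambers_mk.2 ⟨0, by simp⟩
  have he : IsEndpoint v (edgeMk i c) := ⟨hi, c, hm i c, hc⟩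
  have hf : IsEndpoint v (edgeMk i (c * syl j k)) :=
    ⟨hi, _, hm i _, hck⟩
  have hg : IsEndpoint v (edgeMk j c) := ⟨hj, c, hm j c, hc⟩
  refine ⟨he, hf, ?_⟩
  have hne : edgeMk i c ≠ edgeMk i (c * syl j k) := by
    intro h
    obtain ⟨_, m, hm⟩ := edge_mk_eq_iff.1 h
    have h1 := congrArg (fun w => coord w (hyp j 1)) (mul_left_cancel hm)
    simp only [coord_syl_self] at h1
    rw [coord_syl_of_ne (fun h => hij (hyp_one_eq_iff.1 h).symm)] at h1
    exact hk h1
  have h1 : (link v).Adj ⟨_, he⟩ ⟨_, hg⟩ :=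
    ⟨fun h => hij (congrArg (fun x => x.1.1) h), c, hm i c, hm j c⟩
  have h2 : (link v).Adj ⟨_, hg⟩ ⟨_, hf⟩ :=
    ⟨fun h => hij (congrArg (fun x => x.1.1) h).symm, c * syl j k,
      mem_chambers_mk.2 ⟨k, rfl⟩, hm i _⟩
  have hle := SimpleGraph.dist_le (SimpleGraph.Walk.cons h1 (SimpleGraph.Walk.cons h2 .nil))
  simp only [SimpleGraph.Walk.length_cons, SimpleGraph.Walk.length_nil] at hle
  have h0 : (link v).dist ⟨_, he⟩ ⟨_, hf⟩ ≠ 0 := by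
    intro h
    rcases SimpleGraph.dist_eq_zero_iff_eq_or_not_reachable.1 h with h | h
    · exact hne (congrArg Subtype.val h)
    · exact h (h1.reachable.trans h2.reachable)
  have h1 : (link v).dist ⟨_, he⟩ ⟨_, hf⟩ ≠ 1 := by
    intro h
    obtain ⟨_, d, hd, hd'⟩ := SimpleGraph.dist_eq_one_iff_adj.1 h
    exact hne (eq_of_mem_chambers rfl hd hd')
  omega

/-- The vertex of the chamber `c` in which its `i`-th and its `(i+1)`-st edge meet. -/
def vertexMk (i : ZMod p) (c : Chamber p q) : Vertex p q := ⟨i, QuotientGroup.mk c⟩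

/-- The chambers along a wall through the `i`-th edge of `c`, on one side of it: they are reached
from `c` by turning alternately around the two neighbouring edges. -/
def zigzag (c : Chamber p q) (i : ZMod p) (n : ℤ) : Chamber p q :=
  c * (gen p q (i + 1) * gen p q (i - 1)) ^ (n / 2) * gen p q (i + 1) ^ (n % 2)

/-- The vertices of that wall: `zigzagVertex c i n` is the common endpoint of its edges with
numbers `n - 1` and `n`. -/
def zigzagVertex (c : Chamber p q) (i : ZMod p) (n : ℤ) : Vertex p q :=
  vertexMk (if n % 2 = 0 then i - 1 else i) (zigzag c i n)

lemma zigzag_succ_of_even (c : Chamber p q) (i : ZMod p) {n : ℤ} (h : n % 2 = 0) :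
    zigzag c i (n + 1) = zigzag c i n * gen p q (i + 1) := by
  have h1 : (n + 1) / 2 = n / 2 := by omega
  have h2 : (n + 1) % 2 = 1 := by omega
  simp [zigzag, h1, h2, h]

lemma zigzag_succ_of_odd (c : Chamber p q) (i : ZMod p) {n : ℤ} (h : n % 2 = 1) :
    zigzag c i (n + 1) = zigzag c i n * gen p q (i - 1) := by
  have h1 : (n + 1) / 2 = n / 2 + 1 := by omega
  have h2 : (n + 1) % 2 = 0 := by omega
  simp [zigzag, h1, h2, h, zpow_add, mul_assoc]

lemma zigzagVertex_spec (hp : 5 ≤ p) (hq : 3 ≤ q) (c : Chamber p q) (i : ZMod p) (n : ℤ) :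
    zigzagVertex c i n ≠ zigzagVertex c i (n + 1) ∧
      StraightAt (zigzagVertex c i (n + 1)) (edgeMk i (zigzag c i n))
        (edgeMk i (zigzag c i (n + 1))) := by
  have hi : i - 1 ≠ i := fun h => not_near_self hp i (Or.inl h.symm)
  have hi' : i ≠ i + 1 := fun h => not_near_self hp i (Or.inr h)
  rcases Int.emod_two_eq_zero_or_one n with h | h
  · have h' : (n + 1) % 2 = 1 := by omega
    rw [zigzagVertex, zigzagVertex, if_pos h, if_neg (by rw [h']; exact one_ne_zero)]
    refine ⟨fun h => hi (congrArg Sigma.fst h), ?_⟩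
    rw [zigzag_succ_of_even c i h, ← syl_one]
    refine straightAt_of_same_type (Or.inl rfl) (Or.inr rfl) hi' (one_zmod_ne_zero hq) ?_ rfl
    refine QuotientGroup.eq.2 ?_
    rw [inv_mul_cancel_left]
    exact syl_right_mem_vertexGroup i 1
  · have h' : (n + 1) % 2 = 0 := by omega
    rw [zigzagVertex, zigzagVertex, if_pos h', if_neg (by rw [h]; exact one_ne_zero)]
    refine ⟨fun h => hi (congrArg Sigma.fst h).symm, ?_⟩
    rw [zigzag_succ_of_odd c i h, ← syl_one]
    refine straightAt_of_same_type (Or.inr (sub_add_cancel i 1).symm) (Or.inl rfl) hi.symm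
      (one_zmod_ne_zero hq) ?_ rfl
    refine QuotientGroup.eq.2 ?_
    rw [inv_mul_cancel_left]
    exact syl_left_mem_vertexGroup (i - 1) 1

@[simp] lemma zigzag_zero (c : Chamber p q) (i : ZMod p) : zigzag c i 0 = c := by simp [zigzag]

lemma mem_treeWall_self (hp : 5 ≤ p) (hq : 3 ≤ q) (e : Edge p q) : e ∈ treeWall e := by
  obtain ⟨i, c, rfl⟩ := exists_edge_eq e
  have h : IsWall fun n => edgeMk i (zigzag c i n) :=
    ⟨zigzagVertex c i, zigzagVertex_spec hp hq c i⟩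
  exact ⟨_, h, ⟨0, by simp⟩, ⟨0, by simp⟩⟩

lemma fst_eq_of_mem_treeWall {e f : Edge p q} (h : f ∈ treeWall e) : f.1 = e.1 := by
  obtain ⟨γ, hγ, ⟨m, rfl⟩, ⟨n, rfl⟩⟩ := h
  exact hγ.fst_eq n m

lemma mem_halfTreeWall_self (hp : 5 ≤ p) (hq : 3 ≤ q) {v : Vertex p q} {e : Edge p q}
    (h : IsEndpoint v e) : e ∈ halfTreeWall v e := by
  have hh := h
  obtain ⟨hi, c, hc, hcv⟩ := h
  obtain ⟨i, x⟩ := e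
  replace hc : (QuotientGroup.mk c : Chamber p q ⧸ edgeGroup p q i) = x := hc
  subst hc
  obtain ⟨j, y⟩ := v
  replace hcv : (QuotientGroup.mk c : Chamber p q ⧸ vertexGroup p q j) = y := hcv
  subst hcv
  rcases hi with hi | hi
  · -- the wall is run through backwards, since its vertex of type `i` is the end of the edge
    change i = j at hi
    subst hi
    refine ⟨fun n => edgeMk i (zigzag c i (-n)), ⟨by simp; rfl,
      fun n => zigzagVertex c i (1 - n), ?_, hh, fun n => ?_⟩, ⟨0, by simp; rfl⟩⟩
    · have := zigzag_succ_of_even c i (n := 0) (by simp)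
      rw [zero_add, zigzag_zero] at this
      change vertexMk (if (1 - ((0 : ℕ) : ℤ)) % 2 = 0 then i - 1 else i) _ = vertexMk i c
      rw [if_neg (by simp), Nat.cast_zero, sub_zero, this]
      refine congrArg (Sigma.mk i) (QuotientGroup.eq.2 ?_)
      rw [mul_inv_rev, inv_mul_cancel_right, ← syl_one]
      exact inv_mem (syl_right_mem_vertexGroup i 1)
    · have h1 := (zigzagVertex_spec hp hq c i (-n)).1
      have h2 := (zigzagVertex_spec hp hq c i (-(n + 1))).2
      push_cast
      rw [show -(n : ℤ) + 1 = 1 - n by ring] at h1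
      rw [show -((n : ℤ) + 1) + 1 = -n by ring] at h2
      rw [show (1 : ℤ) - (n + 1) = -n by ring]
      exact ⟨h1.symm, h2.symm⟩
  · change i = j + 1 at hi
    obtain rfl : j = i - 1 := by rw [hi]; ring
    refine ⟨fun n => edgeMk i (zigzag c i n), ⟨by simp; rfl,
      fun n => zigzagVertex c i n, ?_, hh, fun n => ?_⟩, ⟨0, by simp; rfl⟩⟩
    · simp [zigzagVertex]
      rfl
    · have := zigzagVertex_spec hp hq c i n
      exact_mod_cast this

/-- Two half-tree-walls attached to each other contain edges of two consecutive types. -/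
lemma IsTwoHalfTreeWalls.exists_types (hp : 5 ≤ p) (hq : 3 ≤ q) {S : Set (Edge p q)}
    (h : IsTwoHalfTreeWalls S) : ∃ i, (∃ e ∈ S, e.1 = i) ∧ ∃ f ∈ S, f.1 = i + 1 := by
  obtain ⟨v, c, e, f, hef, he, hf, hce, hcf, rfl⟩ := h
  have he' := Set.mem_union_left (halfTreeWall v f) (mem_halfTreeWall_self hp hq he)
  have hf' := Set.mem_union_right (halfTreeWall v e) (mem_halfTreeWall_self hp hq hf)
  rcases he.1 with h1 | h1 <;> rcases hf.1 with h2 | h2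
  · exact absurd (eq_of_mem_chambers (h1.trans h2.symm) hce hcf) hef
  · exact ⟨v.1, ⟨e, he', h1⟩, ⟨f, hf', h2⟩⟩
  · exact ⟨v.1, ⟨f, hf', h2⟩, ⟨e, he', h1⟩⟩
  · exact absurd (eq_of_mem_chambers (h1.trans h2.symm) hce hcf) hef

/-! ### Counting the edges of the boundary -/

/-- The boundary edges of layer less than `len z + n`, parametrised by their chambers in the
wedge. -/
lemma truncated_eq_iUnion (hp : 5 ≤ p) (hq : 3 ≤ q) (O z : Chamber p q) (n : ℕ) :
    {e | e ∈ boundaryEdges (ballWedge O (O * z)) ∧ edgeLayer O e < len z + n} =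
      ⋃ j ∈ {j | IsLast z j}, edgeAt O z j '' (alongSet z j ∩ {w | len w ≤ n}) := by
  ext e
  simp only [Set.mem_iUnion]
  constructor
  · rintro ⟨he, hlt⟩
    obtain ⟨j, hj, w, hw, rfl⟩ := (mem_boundaryEdges_iff hp hq O z e).1 he
    refine ⟨j, hj, w, ⟨hw, ?_⟩, rfl⟩
    have := edgeLayer_edgeAt (O := O) hj hw
    change len w ≤ n
    omega
  · rintro ⟨j, hj, w, ⟨hw, hlen⟩, rfl⟩
    refine ⟨(mem_boundaryEdges_iff hp hq O z _).2 ⟨j, hj, w, hw, rfl⟩, ?_⟩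
    have := edgeLayer_edgeAt (O := O) hj hw
    replace hlen : len w ≤ n := hlen
    omega

/-- The layer of a boundary edge is one less than the distance of its chamber in the wedge. -/
lemma edgeLayer_lt_iff (hp : 5 ≤ p) (hq : 3 ≤ q) (O z : Chamber p q) (N : ℕ) {e : Edge p q}
    (he : e ∈ boundaryEdges (ballWedge O (O * z))) :
    edgeLayer O e < N ↔
      ∃ c ∈ e.chambers, c ∈ ballWedge O (O * z) ∧ (network p q).dist O c ≤ N := by
  obtain ⟨j, hj, w, hw, rfl⟩ := (mem_boundaryEdges_iff hp hq O z e).1 he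
  have hlayer := edgeLayer_edgeAt (O := O) hj hw
  have hlen := len_of_mem_alongSet hw
  constructor
  · intro h
    refine ⟨_, mem_edgeAt_chambers.2 ⟨0, rfl⟩, (edgeAt_mem_wedge_iff hp hq O hj hw 0).2 rfl, ?_⟩
    rw [network_dist, inv_mul_cancel_left, syl_zero, mul_one]
    omega
  · rintro ⟨c, hc, hcR, hd⟩
    obtain ⟨k, rfl⟩ := mem_edgeAt_chambers.1 hc
    obtain rfl := (edgeAt_mem_wedge_iff hp hq O hj hw k).1 hcR
    rw [network_dist, inv_mul_cancel_left, syl_zero, mul_one] at hd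
    omega

lemma finite_truncated (hp : 5 ≤ p) (hq : 3 ≤ q) (O z : Chamber p q) (n : ℕ) :
    {e | e ∈ boundaryEdges (ballWedge O (O * z)) ∧ edgeLayer O e < len z + n}.Finite := by
  have : NeZero p := ⟨by omega⟩
  rw [truncated_eq_iUnion hp hq]
  exact (Set.toFinite _).biUnion fun j _ =>
    ((finite_len_le hp hq n).subset Set.inter_subset_right).image _

/-- The boundary has an edge of type `i` exactly if `i` is the type of a last syllable of `z`. -/
lemma exists_boundaryEdges_fst_iff (hp : 5 ≤ p) (hq : 3 ≤ q) (O z : Chamber p q) (i : ZMod p) :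
    (∃ e ∈ boundaryEdges (ballWedge O (O * z)), e.1 = i) ↔ IsLast z i := by
  constructor
  · rintro ⟨e, he, rfl⟩
    obtain ⟨j, hj, w, _, rfl⟩ := (mem_boundaryEdges_iff hp hq O z e).1 he
    exact hj
  · intro hi
    exact ⟨edgeAt O z i 1, (mem_boundaryEdges_iff hp hq O z _).2
      ⟨i, hi, 1, ⟨⟨[], by simp⟩, by simp⟩, rfl⟩, rfl⟩

lemma ncard_truncated_of_single (hp : 5 ≤ p) (hq : 3 ≤ q) (O : Chamber p q) {z : Chamber p q}
    {j : ZMod p} (hz : ∀ i, IsLast z i ↔ i = j) (n : ℕ) :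
    ({e | e ∈ boundaryEdges (ballWedge O (O * z)) ∧ edgeLayer O e < len z + n}.ncard : ℝ) =
      2 / ((q : ℝ) - 2) * (((q : ℝ) - 1) ^ (n + 1) - 1) - 1 := by
  have hset : {j | IsLast z j} = {j} := Set.ext hz
  have hne := sub_one_ne_add_one hp j
  have hnn := not_near_sub_one_add_one hp j
  have hunion := Set.ncard_union_add_ncard_inter _ _ (finite_wordBall hp hq (j - 1) (j + 1) n)
    (finite_wordBall hp hq (j + 1) (j - 1) n)
  rw [wordBall_inter, Set.ncard_singleton, ncard_wordBall hp hq hne hnn,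
    ncard_wordBall hp hq hne.symm fun h => hnn h.symm] at hunion
  rw [truncated_eq_iUnion hp hq, hset, Set.biUnion_singleton, Set.InjOn.ncard_image
    ((edgeAt_injOn hp hq O ((hz j).2 rfl)).mono Set.inter_subset_left), alongSet_eq_of_single hp hz,
    ← cast_sum_pow hq, eq_sub_iff_add_eq]
  rw [two_mul]
  exact_mod_cast hunion

lemma ncard_truncated_of_pair (hp : 5 ≤ p) (hq : 3 ≤ q) (O : Chamber p q) {z : Chamber p q}
    {i : ZMod p} (hz : ∀ j, IsLast z j ↔ j = i ∨ j = i + 1) (n : ℕ) :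
    ({e | e ∈ boundaryEdges (ballWedge O (O * z)) ∧ edgeLayer O e < len z + n}.ncard : ℝ) =
      2 / ((q : ℝ) - 2) * (((q : ℝ) - 1) ^ (n + 1) - 1) := by
  have hset : {j | IsLast z j} = {i, i + 1} := Set.ext hz
  have hii : i ≠ i + 1 := fun h => not_near_self hp i (Or.inr h)
  have h1 : ∀ x, Near i x ↔ x = i + 1 ∨ x = i - 1 := fun x => or_comm
  have h2 : ∀ x, Near (i + 1) x ↔ x = i ∨ x = i + 1 + 1 := fun x => by
    rw [Near, add_sub_cancel_right]
  have hne := sub_one_ne_add_one hp i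
  have hnn := not_near_sub_one_add_one hp i
  have hne' := sub_one_ne_add_one hp (i + 1)
  have hnn' := not_near_sub_one_add_one hp (i + 1)
  rw [add_sub_cancel_right] at hne' hnn'
  have hdis : Disjoint (edgeAt O z i '' wordBall q (i + 1) (i - 1) n)
      (edgeAt O z (i + 1) '' wordBall q i (i + 1 + 1) n) := by
    rw [Set.disjoint_left]
    rintro _ ⟨w, _, rfl⟩ ⟨w', _, h⟩
    exact hii (congrArg Sigma.fst h).symm
  have e1 := alongSet_eq_of_pair hp hz h1 n
  have e2 := alongSet_eq_of_pair hp (fun j => (hz j).trans or_comm) h2 n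
  rw [truncated_eq_iUnion hp hq, hset, Set.biUnion_pair, e1, e2, Set.ncard_union_eq hdis
    ((finite_wordBall hp hq _ _ n).image _) ((finite_wordBall hp hq _ _ n).image _),
    Set.InjOn.ncard_image, Set.InjOn.ncard_image, ncard_wordBall hp hq hne.symm fun h => hnn h.symm,
    ncard_wordBall hp hq hne' hnn', ← cast_sum_pow hq, two_mul, Nat.cast_add]
  · rw [← e2]
    exact (edgeAt_injOn hp hq O ((hz _).2 (Or.inr rfl))).mono Set.inter_subset_left
  · rw [← e1]
    exact (edgeAt_injOn hp hq O ((hz _).2 (Or.inl rfl))).mono Set.inter_subset_left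

end Bourdon

theorem mainTheorem7 (p q : ℕ) (hp : 5 ≤ p) (hq : 3 ≤ q)
    (O z : Bourdon.Chamber p q) (g Λ : ℕ)
    (hg : (Bourdon.network p q).dist O z = g) (hΛ : g ≤ Λ)
    (R : Set (Bourdon.Chamber p q)) (hR : R = Bourdon.ballWedge O z)
    (T : Set (Bourdon.Edge p q))
    (hT : T = {e | e ∈ Bourdon.boundaryEdges R ∧ Bourdon.edgeLayer O e < Λ}) :
    T = {e | e ∈ Bourdon.boundaryEdges R ∧
      ∃ c ∈ e.chambers, c ∈ R ∧ (Bourdon.network p q).dist O c ≤ Λ} ∧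
    T.Finite ∧
    (Bourdon.IsTreeWall (Bourdon.boundaryEdges R) →
      (T.ncard : ℝ) = 2 / ((q : ℝ) - 2) * (((q : ℝ) - 1) ^ (Λ - g + 1) - 1) - 1) ∧
    (Bourdon.IsTwoHalfTreeWalls (Bourdon.boundaryEdges R) →
      (T.ncard : ℝ) = 2 / ((q : ℝ) - 2) * (((q : ℝ) - 1) ^ (Λ - g + 1) - 1)) := by
  open Bourdon in
  obtain ⟨z, rfl⟩ : ∃ y, z = O * y := ⟨O⁻¹ * z, by group⟩
  obtain ⟨n, rfl⟩ := Nat.exists_eq_add_of_le hΛ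
  rw [network_dist, inv_mul_cancel_left] at hg
  subst hg hR hT
  rw [Nat.add_sub_cancel_left]
  have htypes := exists_boundaryEdges_fst_iff hp hq O z
  refine ⟨?_, finite_truncated hp hq O z n, ?_, ?_⟩
  · ext e
    exact and_congr_right fun he => edgeLayer_lt_iff hp hq O z _ he
  · rintro ⟨e, he⟩
    -- a tree-wall has edges of one type only, so `z` has one type of last syllables
    refine ncard_truncated_of_single hp hq O (j := e.1) (fun i => ?_) n
    rw [← htypes, he]
    constructor
    · rintro ⟨f, hf, rfl⟩
      exact fst_eq_of_mem_treeWall hf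
    · rintro rfl
      exact ⟨e, mem_treeWall_self hp hq e, rfl⟩
  · intro h
    obtain ⟨i, hi, hi'⟩ := h.exists_types hp hq
    rw [htypes] at hi hi'
    refine ncard_truncated_of_pair hp hq O (i := i) (fun j => ⟨eq_or_eq_of_isLast hp hi hi', ?_⟩) n
    rintro (rfl | rfl)
    · exact hi
    · exact hi'
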